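/- **Setting.** An episodic MDP with finite state space $\mathcal S$, finite non-empty action space $\mathcal A$, horizon $H\ge 1$, initial law $\nu_0$ and transition kernels $P_1,\dots,P_H$ is *linear* with known features $\phi:\mathcal S\times\mathcal A\to\mathbb R^d$ ($d\ge1$) if $\|\phi(s,a)\|_1\le 1$ for all $(s,a)$ and there are matrices $M_h\in\mathbb R^{d\times|\mathcal S|}$, every row of which has $\ell^1$-norm at most $1$, with $P_h(s'|s,a)=\sum_i\phi_i(s,a)(M_h)_{i,s'}$. Let $\mathcal W\subset[-1,1]^d$ be closed and convex (for example the Euclidean unit ball, or $[0,1]^d$). The unknown cost is *realizable*: $c_{\mathrm{true},h}(s,a)=\langle\phi(s,a),w_{\mathrm{true},h}\rangle$ with $w_{\mathrm{true},h}\in\mathcal W$, $h=1,\dots,H$. For a policy $\pi=(\pi_h)_{h\le H}$, $\pi_h:\mathcal S\to\Delta_{\mathcal A}$, let $V^\pi(s;c)=\mathbb E_\pi[\sum_{h=1}^H c_h(s_h,a_h)\mid s_1=s]$. The expert $\pi_E$ is an arbitrary such policy. **Algorithm (BRIG)** with parameters $K,\alpha,\beta$. Given $\tau_E$ i.i.d.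 expert trajectories, let $\hat e_h$ be the empirical mean of $\phi(s_h,a_h)$ over them. Start with any $w^1_h\in\mathcal W$ and the uniform policy $\pi^1$. In each episode $k=1,\dots,K$: sample a trajectory $(s^k_h,a^k_h,s^k_{h+1})_{h\le H}$ with $\pi^k$; set $w_h^{k+1}=\Pi_{\mathcal W}\big[w_h^k-\alpha(\hat e_h-\phi(s_h^k,a_h^k))\big]$ for every $h$ ($\Pi_{\mathcal W}$ the Euclidean projection); put $V^k_{H+1}=0$ and, for $h=H,\dots,1$, $$\Lambda_h^k=I+\sum_{l\le k}\phi(s_h^l,a_h^l)\phi(s_h^l,a_h^l)^{\top},\qquad v_h^k=(\Lambda_h^k)^{-1}\sum_{l\le k}\phi(s_h^l,a_h^l)V_{h+1}^k(s_{h+1}^l),$$ $$Q_h^k(s,a)=\Big[\langle\phi(s,a),w_h^{k+1}+v_h^k\rangle-\beta\sqrt{\phi(s,a)^{\top}(\Lambda_h^k)^{-1}\phi(s,a)}\Big]_{-(H-h+1)}^{H-h+1},$$ where $[x]_{-b}^{b}$ is truncation to $[-b,b]$; $\pi^{k+1}_h(s)\in\arg\min_a Q_h^k(s,a)$ (ties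 broken by any fixed rule) and $V_h^k(s)=\min_a Q^k_h(s,a)$. The output is $\pi^{\hat k}$ with $\hat k$ uniform on $\{1,\dots,K\}$. **Theorem.** There is a universal constant $C>0$ such that for all $d,H\ge1$ and $0<\varepsilon\le 1/2$ there are a number of episodes $K\ge1$ with $$K\le C\,\frac{H^4d^3\log^2(dH/\varepsilon)}{\varepsilon^2}$$ and an exploration parameter $0\le\beta\le C\,dH\log(dH/\varepsilon)$, depending only on $(d,H,\varepsilon)$, for which the following holds. For every linear episodic MDP, class $\mathcal W$, realizable cost and expert policy as above, and all $\varepsilon_E>0$, BRIG run for $K$ episodes with $\alpha=\sqrt{1/(2K)}$ and this $\beta$ on any number $\tau_E\ge 2H^2d\log(2d)/\varepsilon_E^2$ of expert trajectories is $(\varepsilon+\varepsilon_E)$-suboptimal in expectation: $$\mathbb E\Big[\mathbb E_{s_1\sim\nu_0}\big[V^{\pi^{\hat k}}(s_1;c_{\mathrm{true}})-V^{\pi_E}(s_1;c_{\mathrm{true}})\big]\Big]\le\varepsilon+\varepsilon_E,$$ where the outer expectation is over the expert data, the sampled trajectories and $\hat k$. -/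

import Mathlib

open scoped Matrix BigOperators

noncomputable section

namespace BRIG

/-- Episodic Markov decision process with stages `0, …, H - 1`. -/
structure EpisodicMDP (S : Type*) (A : Type*) (H : ℕ) where
  /-- distribution of the first state -/
  init : PMF S
  /-- `trans h s a` is the law of the state that follows `(s, a)` at stage `h` -/
  trans : Fin H → S → A → PMF S

/-- A (stage dependent, stochastic) policy. -/
abbrev Policy (S : Type*) (A : Type*) (H : ℕ) := Fin H → S → PMF A

/-- A trajectory: states at stages `0, …, H` and actions at stages `0, …, H - 1`. -/
abbrev Trajectory (S : Type*) (A : Type*) (H : ℕ) := (Fin (H + 1) → S) × (Fin H → A)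

variable {S : Type*} {A : Type*} {H d : ℕ}

/-- Probability of the trajectory `τ` when the first state is drawn from `ν` and the actions
are drawn from the policy `π`. -/
def trajProb (M : EpisodicMDP S A H) (ν : PMF S) (π : Policy S A H)
    (τ : Trajectory S A H) : ℝ :=
  (ν (τ.1 0)).toReal *
    ∏ h : Fin H, (π h (τ.1 h.castSucc) (τ.2 h)).toReal *
      (M.trans h (τ.1 h.castSucc) (τ.2 h) (τ.1 h.succ)).toReal

/-- Value function at the first stage: expected total cost of `π` when starting in `s`. -/
def value [Fintype S] [Fintype A] (M : EpisodicMDP S A H) (π : Policy S A H)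
    (c : Fin H → S → A → ℝ) (s : S) : ℝ :=
  ∑ τ : Trajectory S A H, trajProb M (PMF.pure s) π τ *
    ∑ h : Fin H, c h (τ.1 h.castSucc) (τ.2 h)

/-- Expected excess cost of `π` over `π'` when the first state has its law `M.init`. -/
def gap [Fintype S] [Fintype A] (M : EpisodicMDP S A H) (c : Fin H → S → A → ℝ)
    (π π' : Policy S A H) : ℝ :=
  ∑ s : S, (M.init s).toReal * (value M π c s - value M π' c s)

/-- Episodic linear MDP: the rows `φ s a` of the feature matrix have `ℓ¹` norm at most one, and the
transition matrix of every stage factorizes through it as `Φ M_h`, where the rows of `M_h` have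
`ℓ¹` norm at most one. -/
def IsLinearMDP [Fintype S] (M : EpisodicMDP S A H) (φ : S → A → Fin d → ℝ) : Prop :=
  (∀ s a, ∑ i, |φ s a i| ≤ 1) ∧
    ∃ m : Fin H → Matrix (Fin d) S ℝ,
      (∀ h i, ∑ s', |m h i s'| ≤ 1) ∧
      ∀ h s a s', (M.trans h s a s').toReal = ∑ i, φ s a i * m h i s'

/-- Realizable cost: at every stage the cost is linear in the features, with a weight vector
in the class `W`. -/
def IsRealizable (φ : S → A → Fin d → ℝ) (W : Set (Fin d → ℝ)) (c : Fin H → S → A → ℝ) : Prop :=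
  ∃ w : Fin H → Fin d → ℝ, (∀ h, w h ∈ W) ∧ ∀ h s a, c h s a = φ s a ⬝ᵥ w h

/-- `y` is a Euclidean projection of `x` onto `W`. -/
def IsProj (W : Set (Fin d → ℝ)) (x y : Fin d → ℝ) : Prop :=
  y ∈ W ∧ ∀ z ∈ W, (x - y) ⬝ᵥ (x - y) ≤ (x - z) ⬝ᵥ (x - z)

open Classical in
/-- The Euclidean projection of `x` onto `W` (it exists when `W` is closed and non-empty). -/
def proj (W : Set (Fin d → ℝ)) (x : Fin d → ℝ) : Fin d → ℝ :=
  if hx : ∃ y, IsProj W x y then hx.choose else x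

/-- Inputs of the algorithm BRIG. -/
structure Input (S : Type*) (A : Type*) (d H : ℕ) where
  /-- rows of the feature matrix -/
  φ : S → A → Fin d → ℝ
  /-- class of cost weights -/
  W : Set (Fin d → ℝ)
  /-- exploration parameter -/
  β : ℝ
  /-- step size of the cost update -/
  α : ℝ
  /-- initial cost weights -/
  w₁ : Fin H → Fin d → ℝ
  /-- selection of a minimizer, i.e. tie-breaking rule of the greedy policy -/
  argmin : (A → ℝ) → A

/-- Empirical expert feature expectation at stage `h`. -/
def expertFeatures (I : Input S A d H) {n : ℕ} (D : Fin n → Trajectory S A H) (h : Fin H) :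
    Fin d → ℝ :=
  (n : ℝ)⁻¹ • ∑ i, I.φ ((D i).1 h.castSucc) ((D i).2 h)

/-- Cost weights after the episodes `ω 0, …, ω (k - 1)`: projected online gradient steps,
where `e h` is the expert feature estimate at stage `h`. -/
def costWeight (I : Input S A d H) (e : Fin H → Fin d → ℝ) :
    (k : ℕ) → (Fin k → Trajectory S A H) → Fin H → Fin d → ℝ
  | 0, _ => I.w₁
  | k + 1, ω => fun h => proj I.W
      (costWeight I e k (Fin.init ω) h -
        I.α • (e h - I.φ ((ω (Fin.last k)).1 h.castSucc) ((ω (Fin.last k)).2 h)))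

/-- Regularized feature covariance of the collected data at stage `h`. -/
def gram (I : Input S A d H) {k : ℕ} (ω : Fin k → Trajectory S A H) (h : Fin H) :
    Matrix (Fin d) (Fin d) ℝ :=
  ∑ i, Matrix.vecMulVec (I.φ ((ω i).1 h.castSucc) ((ω i).2 h))
    (I.φ ((ω i).1 h.castSucc) ((ω i).2 h)) + 1

/-- Ridge regression of the next-stage value `V` on the features of stage `h`. -/
def ridge (I : Input S A d H) {k : ℕ} (ω : Fin k → Trajectory S A H) (h : Fin H) (V : S → ℝ) :
    Fin d → ℝ :=
  (gram I ω h)⁻¹ *ᵥ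
    ∑ i, V ((ω i).1 h.succ) • I.φ ((ω i).1 h.castSucc) ((ω i).2 h)

/-- Exploration bonus. -/
def bonus (I : Input S A d H) {k : ℕ} (ω : Fin k → Trajectory S A H) (h : Fin H) (s : S) (a : A) :
    ℝ :=
  I.β * Real.sqrt (I.φ s a ⬝ᵥ ((gram I ω h)⁻¹ *ᵥ I.φ s a))

/-- Truncation of `x` to the interval `[-b, b]`. -/
def clip (b x : ℝ) : ℝ := max (-b) (min b x)

/-- Optimistic action values at stage `h` with cost weight `w` and next-stage value `V`. With stages
counted from `0`, there are `H - h` stages left. -/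
def qStep (I : Input S A d H) {k : ℕ} (ω : Fin k → Trajectory S A H) (h : Fin H)
    (w : Fin d → ℝ) (V : S → ℝ) (s : S) (a : A) : ℝ :=
  clip ((H : ℝ) - (h : ℕ))
    (I.φ s a ⬝ᵥ w + I.φ s a ⬝ᵥ ridge I ω h V - bonus I ω h s a)

/-- Optimistic values, by backward recursion from `0` at stage `H`; at each stage the value is
that of the greedy action. -/
def vFun (I : Input S A d H) {k : ℕ} (ω : Fin k → Trajectory S A H)
    (w : Fin H → Fin d → ℝ) (h : Fin (H + 1)) : S → ℝ :=
  Fin.reverseInduction (motive := fun _ => S → ℝ) (fun _ => 0)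
    (fun h V s => qStep I ω h (w h) V s (I.argmin (qStep I ω h (w h) V s))) h

/-- Optimistic action values. -/
def qFun (I : Input S A d H) {k : ℕ} (ω : Fin k → Trajectory S A H)
    (w : Fin H → Fin d → ℝ) (h : Fin H) : S → A → ℝ :=
  qStep I ω h (w h) (vFun I ω w h.succ)

/-- The policy that BRIG plays after the episodes `ω 0, …, ω (k - 1)`: uniform when there is no
data, and otherwise greedy for the optimistic action values, which are computed with the
cost weights already updated with the last episode. -/
def policy [Fintype A] [Nonempty A] (I : Input S A d H) (e : Fin H → Fin d → ℝ) :
    (k : ℕ) → (Fin k → Trajectory S A H) → Policy S A H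
  | 0, _ => fun _ _ => PMF.uniformOfFintype A
  | k + 1, ω => fun h s => PMF.pure (I.argmin (qFun I ω (costWeight I e (k + 1) ω) h s))

/-- The policy of episode `k` (counted from `0`) in the run `ω`; it depends only on the
first `k` episodes. -/
def playedPolicy [Fintype A] [Nonempty A] (I : Input S A d H) (e : Fin H → Fin d → ℝ) {K : ℕ}
    (ω : Fin K → Trajectory S A H) (k : Fin K) : Policy S A H :=
  policy I e k (Fin.take k k.is_lt.le ω)

/-- Probability that the episodes of a run of BRIG in the MDP `M` are `ω`. -/
def runProb [Fintype A] [Nonempty A] (M : EpisodicMDP S A H) (I : Input S A d H)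
    (e : Fin H → Fin d → ℝ) {K : ℕ} (ω : Fin K → Trajectory S A H) : ℝ :=
  ∏ k, trajProb M M.init (playedPolicy I e ω k) (ω k)

/-- Probability that `n` independent trajectories of the expert `πE` are `D`. -/
def datasetProb (M : EpisodicMDP S A H) (πE : Policy S A H) {n : ℕ}
    (D : Fin n → Trajectory S A H) : ℝ :=
  ∏ i, trajProb M M.init πE (D i)

/-- Expected suboptimality, with respect to the expert `πE` and under the cost `c`, of the output
of BRIG run for `K` episodes on `n` expert trajectories. The output is the policy of a uniformly
drawn episode; the expectation is over the expert data, the episodes and that draw. -/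
def expectedSuboptimality [Fintype S] [Fintype A] [Nonempty A] (M : EpisodicMDP S A H)
    (I : Input S A d H) (c : Fin H → S → A → ℝ) (πE : Policy S A H) (K n : ℕ) : ℝ :=
  ∑ D : Fin n → Trajectory S A H, datasetProb M πE D *
    ∑ ω : Fin K → Trajectory S A H, runProb M I (expertFeatures I D) ω *
      ((K : ℝ)⁻¹ * ∑ k, gap M c (playedPolicy I (expertFeatures I D) ω k) πE)

end BRIG

end

/-! The gap between the policy of an episode and the expert under the true cost splits exactly into
three terms (`gap_decomposition`): the gap under the weights in use, the regret of those weights on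
the linear losses given by `e h` minus the features of the policy, and an error linear in the
estimation error of the expert features. Only expectations are needed, so each term is averaged
rather than controlled along the whole run.

Regret of the weights. The weights of an episode are determined by the past, so a sampled feature
may be replaced by its conditional mean. Projected gradient descent then gives a telescoping squared
distance (`sum_pathMean_costWeight_le`).

Expert error. Against the fixed true weights it has mean zero. Against the data-dependent weights it
is at most the `ℓ¹` error, whose mean per stage is of order `√(d / n)` because the coordinate
variances sum to at most `1 / n`. Hence order `H ^ 2 * d / εE ^ 2` trajectories suffice, with no
logarithm.

Gap under the current weights. This is least-squares value iteration with optimism. If the bonus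
dominates the regression error, the computed value is a lower bound for the cost of every policy,
and the greedy policy exceeds it by at most twice its expected bonuses. The next episode is drawn
from that same policy, so these bonuses are charged to the expected growth of log-determinants,
which telescopes over the episodes (`totalCost_bonus_le`, `meanLogDet_le`).

The bonus does dominate with high probability. For a fixed direction and a fixed next-stage value,
an exponential supermartingale has mean at most one (`pathMean_exp_exponent_le`). The regressed
value depends on the data, but it lies near a finite class described by `d + d ^ 2` rounded
parameters. The cost weights are absorbed into the linear part, so their adaptivity enlarges
nothing. A union bound over this class and over rounded directions yields a self-normalized bound
(`invForm_noiseSum_le`). The logarithm of the size of the net is of order `d ^ 2 * log (d * H / ε)`,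
whence a bonus of order `d * H * √(log (d * H / ε))`. -/

open scoped Matrix BigOperators

noncomputable section

namespace BRIG

variable {S : Type*} {A : Type*} {H d : ℕ}

/-! ### Finite expectations -/

section Mean

variable {T : Type*} [Fintype T]

/-- `p` is a probability mass function on a finite type. -/
def IsProb (p : T → ℝ) : Prop := (∀ t, 0 ≤ p t) ∧ ∑ t, p t = 1

/-- Expectation of `F` under the weights `p`. -/
def mean (p F : T → ℝ) : ℝ := ∑ t, p t * F t

theorem mean_add (p F G : T → ℝ) : mean p (fun t => F t + G t) = mean p F + mean p G := by
  simp only [mean, mul_add, Finset.sum_add_distrib]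

theorem mean_sub (p F G : T → ℝ) : mean p (fun t => F t - G t) = mean p F - mean p G := by
  simp only [mean, mul_sub, Finset.sum_sub_distrib]

theorem mean_const_mul (p F : T → ℝ) (a : ℝ) : mean p (fun t => a * F t) = a * mean p F := by
  simp only [mean, Finset.mul_sum]
  exact Finset.sum_congr rfl fun t _ => by ring

theorem mean_mul_const (p F : T → ℝ) (a : ℝ) : mean p (fun t => F t * a) = mean p F * a := by
  simp only [mean, Finset.sum_mul]
  exact Finset.sum_congr rfl fun t _ => by ring

theorem mean_sum {ι : Type*} (p : T → ℝ) (s : Finset ι) (F : ι → T → ℝ) :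
    mean p (fun t => ∑ i ∈ s, F i t) = ∑ i ∈ s, mean p (F i) := by
  simp only [mean, Finset.mul_sum]
  exact Finset.sum_comm

theorem IsProb.mean_const {p : T → ℝ} (hp : IsProb p) (a : ℝ) : mean p (fun _ => a) = a := by
  simp only [mean, ← Finset.sum_mul, hp.2, one_mul]

theorem IsProb.mean_mono {p : T → ℝ} (hp : IsProb p) {F G : T → ℝ}
    (h : ∀ t, p t ≠ 0 → F t ≤ G t) : mean p F ≤ mean p G := by
  refine Finset.sum_le_sum fun t _ => ?_
  by_cases ht : p t = 0
  · simp [ht]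
  · exact mul_le_mul_of_nonneg_left (h t ht) (hp.1 t)

theorem IsProb.mean_le_of_le {p : T → ℝ} (hp : IsProb p) {F : T → ℝ} {a : ℝ}
    (h : ∀ t, F t ≤ a) : mean p F ≤ a :=
  (hp.mean_mono fun t _ => h t).trans_eq (hp.mean_const a)

theorem IsProb.le_mean_of_le {p : T → ℝ} (hp : IsProb p) {F : T → ℝ} {a : ℝ}
    (h : ∀ t, a ≤ F t) : a ≤ mean p F :=
  (hp.mean_const a).symm.trans_le (hp.mean_mono fun t _ => h t)

theorem IsProb.abs_mean_le {p : T → ℝ} (hp : IsProb p) {F : T → ℝ} {a : ℝ}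
    (h : ∀ t, |F t| ≤ a) : |mean p F| ≤ a :=
  abs_le.2 ⟨hp.le_mean_of_le fun t => (abs_le.1 (h t)).1,
    hp.mean_le_of_le fun t => (abs_le.1 (h t)).2⟩

theorem isProb_pmf (p : PMF T) : IsProb (fun t => (p t).toReal) := by
  refine ⟨fun t => ENNReal.toReal_nonneg, ?_⟩
  rw [← ENNReal.toReal_sum fun t _ => p.apply_ne_top t, ← tsum_fintype (L := .unconditional T),
    p.tsum_coe, ENNReal.toReal_one]

end Mean

/-! ### Adaptively generated sequences -/

section Path

variable {T : Type*}

/-- Probability of a sequence whose next element is drawn from a law that depends on the past. -/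
def pathProb (κ : (k : ℕ) → (Fin k → T) → T → ℝ) (n : ℕ) (ω : Fin n → T) : ℝ :=
  ∏ k : Fin n, κ k (Fin.take k k.is_lt.le ω) (ω k)

variable {κ : (k : ℕ) → (Fin k → T) → T → ℝ}

theorem pathProb_snoc (n : ℕ) (ω : Fin n → T) (t : T) :
    pathProb κ (n + 1) (Fin.snoc (α := fun _ => T) ω t) = pathProb κ n ω * κ n ω t := by
  unfold pathProb
  rw [Fin.prod_univ_castSucc]
  congr 1
  · refine Finset.prod_congr rfl fun k _ => ?_
    rw [Fin.snoc_castSucc]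
    congr 1
    funext i
    have : Fin.castLE (k.castSucc.is_lt.le) i = (Fin.castLE k.is_lt.le i).castSucc := rfl
    rw [Fin.take_apply, Fin.take_apply]
    exact Fin.snoc_castSucc (α := fun _ => T) t ω (Fin.castLE k.is_lt.le i)
  · rw [Fin.snoc_last]
    congr 1
    funext i
    exact Fin.snoc_castSucc (α := fun _ => T) t ω i

variable [Fintype T]

/-- Expectation over an adaptively generated sequence of length `n`. -/
def pathMean (κ : (k : ℕ) → (Fin k → T) → T → ℝ) (n : ℕ) (F : (Fin n → T) → ℝ) : ℝ :=
  mean (pathProb κ n) F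

theorem pathMean_zero (F : (Fin 0 → T) → ℝ) : pathMean κ 0 F = F Fin.elim0 := by
  unfold pathMean mean pathProb
  rw [Fintype.sum_unique]
  simp only [Finset.univ_eq_empty, Finset.prod_empty, one_mul]
  congr 1

/-- The tower property: condition on all but the last element. Every statement about adaptive
sequences below is an induction through this identity. -/
theorem pathMean_succ (n : ℕ) (F : (Fin (n + 1) → T) → ℝ) :
    pathMean κ (n + 1) F =
      pathMean κ n fun ω => mean (κ n ω) fun t => F (Fin.snoc (α := fun _ => T) ω t) := by
  unfold pathMean mean
  rw [← (Fin.snocEquiv fun _ : Fin (n + 1) => T).sum_comp, Fintype.sum_prod_type_right]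
  refine Finset.sum_congr rfl fun ω _ => ?_
  rw [Finset.mul_sum]
  refine Finset.sum_congr rfl fun t _ => ?_
  have := pathProb_snoc (κ := κ) n ω t
  simp only [Fin.snocEquiv, Equiv.coe_fn_mk]
  rw [this, mul_assoc]

theorem isProb_pathProb (hκ : ∀ k ω, IsProb (κ k ω)) (n : ℕ) : IsProb (pathProb κ n) := by
  refine ⟨fun ω => Finset.prod_nonneg fun k _ => (hκ _ _).1 _, ?_⟩
  suffices h : pathMean κ n (fun _ => 1) = 1 by simpa [pathMean, mean] using h
  induction n with
  | zero => exact pathMean_zero _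
  | succ n ih => rw [pathMean_succ]; simpa only [(hκ _ _).mean_const] using ih

/-- Later elements integrate to one. This lets the policy of an episode, which sees only earlier
data, be averaged over that prefix of the run alone. -/
theorem pathMean_take (hκ : ∀ k ω, IsProb (κ k ω)) {m n : ℕ} (h : m ≤ n)
    (F : (Fin m → T) → ℝ) : pathMean κ n (fun ω => F (Fin.take m h ω)) = pathMean κ m F := by
  induction n, h using Nat.le_induction with
  | base => simp
  | succ n h ih =>
    rw [pathMean_succ, ← ih]
    congr 1
    funext ω
    have : ∀ t, Fin.take m (Nat.le_succ_of_le h) (Fin.snoc (α := fun _ => T) ω t)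
        = Fin.take m h ω := fun t => by
      funext i
      exact Fin.snoc_castSucc (α := fun _ => T) t ω (Fin.castLE h i)
    simp only [this, (hκ _ _).mean_const]

end Path

/-! ### Trajectories -/

section Trajectory

/-- The decision process that remains after the first stage. -/
def EpisodicMDP.tail (M : EpisodicMDP S A (H + 1)) : EpisodicMDP S A H :=
  ⟨M.init, fun h => M.trans h.succ⟩

/-- A trajectory is its first state-action pair followed by a shorter trajectory. -/
def trajectoryCons : (S × A) × Trajectory S A H ≃ Trajectory S A (H + 1) where
  toFun x := (Fin.cons x.1.1 x.2.1, Fin.cons x.1.2 x.2.2)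
  invFun τ := ((τ.1 0, τ.2 0), (Fin.tail τ.1, Fin.tail τ.2))
  left_inv x := by simp
  right_inv τ := by simp

theorem policy_ne_zero_of_trajProb_ne_zero {M : EpisodicMDP S A H} {ν : PMF S} {π : Policy S A H}
    {τ : Trajectory S A H} (hτ : trajProb M ν π τ ≠ 0) (h : Fin H) :
    π h (τ.1 h.castSucc) (τ.2 h) ≠ 0 := by
  intro h0
  apply hτ
  unfold trajProb
  rw [Finset.prod_eq_zero (Finset.mem_univ h) (by simp [h0]), mul_zero]

variable [Fintype S] [Fintype A]

theorem mean_trajProb_zero (M : EpisodicMDP S A 0) (ν : PMF S) (π : Policy S A 0)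
    (F : Trajectory S A 0 → ℝ) :
    mean (trajProb M ν π) F = mean (fun s => (ν s).toReal) fun s => F (fun _ => s, Fin.elim0) := by
  unfold mean
  rw [Fintype.sum_prod_type, ← Equiv.sum_comp (Equiv.funUnique (Fin 1) S).symm]
  refine Finset.sum_congr rfl fun s _ => ?_
  rw [Fintype.sum_unique]
  simp only [trajProb, Finset.univ_eq_empty, Finset.prod_empty, mul_one]
  congr 2

/-- Peeling off the first stage turns claims about trajectories into inductions on the horizon. The
initial law `ν` is a separate argument of `trajProb`, so that the shorter process can be restarted
from `M.trans 0 s a`; the field `init` of `M.tail` plays no role. -/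
theorem mean_trajProb_succ (M : EpisodicMDP S A (H + 1)) (ν : PMF S) (π : Policy S A (H + 1))
    (F : Trajectory S A (H + 1) → ℝ) :
    mean (trajProb M ν π) F =
      mean (fun s => (ν s).toReal) fun s => mean (fun a => (π 0 s a).toReal) fun a =>
        mean (trajProb M.tail (M.trans 0 s a) fun h => π h.succ) fun τ =>
          F (trajectoryCons ((s, a), τ)) := by
  unfold mean
  rw [← trajectoryCons.sum_comp, Fintype.sum_prod_type, Fintype.sum_prod_type]
  refine Finset.sum_congr rfl fun s _ => ?_
  rw [Finset.mul_sum]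
  refine Finset.sum_congr rfl fun a _ => ?_
  rw [Finset.mul_sum, Finset.mul_sum]
  refine Finset.sum_congr rfl fun τ _ => ?_
  simp only [trajProb, trajectoryCons, Equiv.coe_fn_mk, Fin.prod_univ_succ, Fin.cons_zero,
    Fin.cons_succ, Fin.castSucc_zero, EpisodicMDP.tail, ← Fin.succ_castSucc]
  ring

theorem isProb_trajProb (M : EpisodicMDP S A H) (ν : PMF S) (π : Policy S A H) :
    IsProb (trajProb M ν π) := by
  refine ⟨fun τ => mul_nonneg ENNReal.toReal_nonneg (Finset.prod_nonneg fun h _ =>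
    mul_nonneg ENNReal.toReal_nonneg ENNReal.toReal_nonneg), ?_⟩
  suffices h : mean (trajProb M ν π) (fun _ => 1) = 1 by simpa [mean] using h
  induction H generalizing ν with
  | zero => rw [mean_trajProb_zero, (isProb_pmf ν).mean_const]
  | succ H ih =>
    rw [mean_trajProb_succ]
    simp only [ih, (isProb_pmf _).mean_const]

/-- Expected value of `f` at the state that follows `(s, a)` at stage `h`. -/
def nextMean (M : EpisodicMDP S A H) (h : Fin H) (f : S → ℝ) (s : S) (a : A) : ℝ :=
  mean (fun s' => (M.trans h s a s').toReal) f

theorem mean_trajProb_initial (M : EpisodicMDP S A H) (ν : PMF S) (π : Policy S A H)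
    (F : S → ℝ) :
    mean (trajProb M ν π) (fun τ => F (τ.1 0)) = mean (fun s => (ν s).toReal) F := by
  cases H with
  | zero => exact mean_trajProb_zero _ _ _ _
  | succ H =>
    rw [mean_trajProb_succ]
    simp only [trajectoryCons, Equiv.coe_fn_mk, Fin.cons_zero, (isProb_trajProb _ _ _).mean_const,
      (isProb_pmf _).mean_const]

/-- Markov property of the trajectories. -/
theorem mean_trajProb_next (M : EpisodicMDP S A H) (ν : PMF S) (π : Policy S A H) (h : Fin H)
    (G : S → A → S → ℝ) :
    mean (trajProb M ν π) (fun τ => G (τ.1 h.castSucc) (τ.2 h) (τ.1 h.succ)) =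
      mean (trajProb M ν π) (fun τ => nextMean M h (G (τ.1 h.castSucc) (τ.2 h))
        (τ.1 h.castSucc) (τ.2 h)) := by
  induction H generalizing ν with
  | zero => exact h.elim0
  | succ H ih =>
    rw [mean_trajProb_succ, mean_trajProb_succ]
    congr 1
    funext s
    congr 1
    funext a
    refine Fin.cases ?_ (fun h => ?_) h
    · simp only [trajectoryCons, Equiv.coe_fn_mk, Fin.castSucc_zero, Fin.cons_zero, Fin.cons_succ,
        (isProb_trajProb _ _ _).mean_const]
      rw [mean_trajProb_initial]
      rfl
    · simp only [trajectoryCons, Equiv.coe_fn_mk, ← Fin.succ_castSucc, Fin.cons_succ]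
      exact ih M.tail (M.trans 0 s a) (fun h => π h.succ) h

/-- Total cost of a trajectory. -/
def totalCost (c : Fin H → S → A → ℝ) (τ : Trajectory S A H) : ℝ :=
  ∑ h, c h (τ.1 h.castSucc) (τ.2 h)

theorem mean_value (M : EpisodicMDP S A H) (π : Policy S A H) (c : Fin H → S → A → ℝ) :
    mean (fun s => (M.init s).toReal) (value M π c) =
      mean (trajProb M M.init π) (totalCost c) := by
  have key : ∀ τ, ∑ s, (M.init s).toReal * trajProb M (PMF.pure s) π τ
      = trajProb M M.init π τ := fun τ => by
    classical
    simp only [trajProb, ← mul_assoc, PMF.pure_apply]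
    rw [← Finset.sum_mul]
    congr 1
    rw [Finset.sum_eq_single (τ.1 0)] <;> simp +contextual [eq_comm]
  simp only [mean, value, Finset.mul_sum]
  rw [Finset.sum_comm]
  refine Finset.sum_congr rfl fun τ _ => ?_
  rw [← key τ, Finset.sum_mul]
  exact Finset.sum_congr rfl fun s _ => by simp only [totalCost, Finset.mul_sum, mul_assoc]

theorem gap_eq (M : EpisodicMDP S A H) (c : Fin H → S → A → ℝ) (π π' : Policy S A H) :
    gap M c π π' = mean (trajProb M M.init π) (totalCost c)
      - mean (trajProb M M.init π') (totalCost c) := by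
  rw [← mean_value, ← mean_value, ← mean_sub]
  rfl

end Trajectory

/-! ### Vectors with the `ℓ¹` norm bound -/

section Vectors

theorem abs_dotProduct_le {u v : Fin d → ℝ} {a : ℝ} (hu : ∑ i, |u i| ≤ 1) (hv : ∀ i, |v i| ≤ a)
    (ha : 0 ≤ a) : |u ⬝ᵥ v| ≤ a := by
  calc |u ⬝ᵥ v| ≤ ∑ i, |u i * v i| := Finset.abs_sum_le_sum_abs _ _
    _ ≤ ∑ i, |u i| * a := Finset.sum_le_sum fun i _ => by
        rw [abs_mul]; exact mul_le_mul_of_nonneg_left (hv i) (abs_nonneg _)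
    _ = (∑ i, |u i|) * a := by rw [Finset.sum_mul]
    _ ≤ 1 * a := mul_le_mul_of_nonneg_right hu ha
    _ = a := one_mul a

theorem dotProduct_self_le_sq {u : Fin d → ℝ} {a : ℝ} (hu : ∑ i, |u i| ≤ a) : u ⬝ᵥ u ≤ a ^ 2 := by
  calc u ⬝ᵥ u = ∑ i, |u i| ^ 2 := Finset.sum_congr rfl fun i _ => by rw [sq_abs, sq]
    _ ≤ (∑ i, |u i|) ^ 2 := Finset.sum_sq_le_sq_sum_of_nonneg fun i _ => abs_nonneg _
    _ ≤ a ^ 2 := pow_le_pow_left₀ (Finset.sum_nonneg fun i _ => abs_nonneg _) hu 2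

theorem dotProduct_self_nonneg' (u : Fin d → ℝ) : 0 ≤ u ⬝ᵥ u :=
  Finset.sum_nonneg fun i _ => mul_self_nonneg (u i)

theorem dotProduct_self_le_of_abs_le {u : Fin d → ℝ} {a : ℝ} (hu : ∀ i, |u i| ≤ a) :
    u ⬝ᵥ u ≤ d * a ^ 2 := by
  calc u ⬝ᵥ u ≤ ∑ _i : Fin d, a ^ 2 := Finset.sum_le_sum fun i _ => by
        rw [← sq, ← sq_abs]; exact pow_le_pow_left₀ (abs_nonneg _) (hu i) 2
    _ = d * a ^ 2 := by simp

theorem dotProduct_sq_le (u v : Fin d → ℝ) : (u ⬝ᵥ v) ^ 2 ≤ (u ⬝ᵥ u) * (v ⬝ᵥ v) := by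
  simpa only [dotProduct, ← sq] using Finset.sum_mul_sq_le_sq_mul_sq Finset.univ u v

theorem abs_apply_le_of_dotProduct_self_le {u : Fin d → ℝ} {a : ℝ} (ha : 0 ≤ a)
    (hu : u ⬝ᵥ u ≤ a ^ 2) (i : Fin d) : |u i| ≤ a := by
  refine abs_le_of_sq_le_sq (le_trans ?_ hu) ha
  rw [sq]
  exact Finset.single_le_sum (f := fun i => u i * u i) (fun i _ => mul_self_nonneg _)
    (Finset.mem_univ i)

theorem sum_abs_sum_smul_le {ι : Type*} (s : Finset ι) {x : ι → Fin d → ℝ}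
    (hx : ∀ i, ∑ j, |x i j| ≤ 1) {y : ι → ℝ} {a : ℝ} (hy : ∀ i ∈ s, |y i| ≤ a) :
    ∑ j, |(∑ i ∈ s, y i • x i) j| ≤ s.card * a := by
  calc ∑ j, |(∑ i ∈ s, y i • x i) j| ≤ ∑ j, ∑ i ∈ s, |y i| * |x i j| :=
        Finset.sum_le_sum fun j _ => by
          rw [Finset.sum_apply]
          refine (Finset.abs_sum_le_sum_abs _ _).trans_eq (Finset.sum_congr rfl fun i _ => ?_)
          rw [Pi.smul_apply, smul_eq_mul, abs_mul]
    _ = ∑ i ∈ s, |y i| * ∑ j, |x i j| := by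
        rw [Finset.sum_comm]; simp only [Finset.mul_sum]
    _ ≤ ∑ i ∈ s, a := Finset.sum_le_sum fun i hi =>
        (mul_le_of_le_one_right (abs_nonneg _) (hx i)).trans (hy i hi)
    _ = s.card * a := by simp

end Vectors

/-! ### Regularized Gram matrices -/

section Gram

variable {k : ℕ}

/-- Identity plus the Gram matrix of the vectors `x i`. -/
def regGram (x : Fin k → Fin d → ℝ) : Matrix (Fin d) (Fin d) ℝ :=
  ∑ i, Matrix.vecMulVec (x i) (x i) + 1

/-- The bilinear form of the inverse of `regGram x`. -/
def invForm (x : Fin k → Fin d → ℝ) (u v : Fin d → ℝ) : ℝ := u ⬝ᵥ ((regGram x)⁻¹ *ᵥ v)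

theorem regGram_mulVec (x : Fin k → Fin d → ℝ) (u : Fin d → ℝ) :
    regGram x *ᵥ u = ∑ i, (x i ⬝ᵥ u) • x i + u := by
  rw [regGram, Matrix.add_mulVec, Matrix.sum_mulVec, Matrix.one_mulVec]
  simp only [Matrix.vecMulVec_mulVec, op_smul_eq_smul]

theorem dotProduct_regGram_mulVec (x : Fin k → Fin d → ℝ) (u v : Fin d → ℝ) :
    u ⬝ᵥ (regGram x *ᵥ v) = ∑ i, (x i ⬝ᵥ u) * (x i ⬝ᵥ v) + u ⬝ᵥ v := by
  rw [regGram_mulVec, dotProduct_add, dotProduct_sum]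
  congr 1
  refine Finset.sum_congr rfl fun i _ => ?_
  rw [dotProduct_smul, smul_eq_mul, dotProduct_comm u, mul_comm]

theorem posDef_regGram (x : Fin k → Fin d → ℝ) : (regGram x).PosDef :=
  Matrix.PosDef.posSemidef_add
    (Matrix.posSemidef_sum _ fun i _ => Matrix.posSemidef_vecMulVec_self_star (x i))
    Matrix.PosDef.one

theorem det_regGram_pos (x : Fin k → Fin d → ℝ) : 0 < (regGram x).det := (posDef_regGram x).det_pos

theorem isUnit_det_regGram (x : Fin k → Fin d → ℝ) : IsUnit (regGram x).det :=
  (det_regGram_pos x).ne'.isUnit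

theorem regGram_mulVec_inv (x : Fin k → Fin d → ℝ) (u : Fin d → ℝ) :
    regGram x *ᵥ ((regGram x)⁻¹ *ᵥ u) = u := by
  rw [Matrix.mulVec_mulVec, Matrix.mul_nonsing_inv _ (isUnit_det_regGram x), Matrix.one_mulVec]

theorem inv_regGram_mulVec (x : Fin k → Fin d → ℝ) (u : Fin d → ℝ) :
    (regGram x)⁻¹ *ᵥ (regGram x *ᵥ u) = u := by
  rw [Matrix.mulVec_mulVec, Matrix.nonsing_inv_mul _ (isUnit_det_regGram x), Matrix.one_mulVec]

theorem invForm_eq (x : Fin k → Fin d → ℝ) (u v : Fin d → ℝ) :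
    invForm x u v = ((regGram x)⁻¹ *ᵥ u) ⬝ᵥ (regGram x *ᵥ ((regGram x)⁻¹ *ᵥ v)) := by
  rw [dotProduct_regGram_mulVec, invForm]
  conv_lhs => rw [← regGram_mulVec_inv x u, dotProduct_comm, dotProduct_regGram_mulVec]
  rw [dotProduct_comm ((regGram x)⁻¹ *ᵥ v)]
  simp only [mul_comm]

theorem invForm_comm (x : Fin k → Fin d → ℝ) (u v : Fin d → ℝ) :
    invForm x u v = invForm x v u := by
  rw [invForm_eq, dotProduct_regGram_mulVec, invForm_eq, dotProduct_regGram_mulVec,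
    dotProduct_comm ((regGram x)⁻¹ *ᵥ v)]
  simp only [mul_comm]

theorem inv_mulVec_self_le_invForm (x : Fin k → Fin d → ℝ) (u : Fin d → ℝ) :
    ((regGram x)⁻¹ *ᵥ u) ⬝ᵥ ((regGram x)⁻¹ *ᵥ u) ≤ invForm x u u := by
  rw [invForm_eq, dotProduct_regGram_mulVec]
  exact le_add_of_nonneg_left (Finset.sum_nonneg fun i _ => mul_self_nonneg _)

theorem invForm_self_nonneg (x : Fin k → Fin d → ℝ) (u : Fin d → ℝ) : 0 ≤ invForm x u u :=
  (dotProduct_self_nonneg' _).trans (inv_mulVec_self_le_invForm x u)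

/-- The regularizer makes the Gram matrix at least the identity. By Cauchy–Schwarz the square of the
form is at most `u ⬝ᵥ u` times the squared length of the inverse applied to `u`, and that length is
itself bounded by the form. -/
theorem invForm_self_le (x : Fin k → Fin d → ℝ) (u : Fin d → ℝ) : invForm x u u ≤ u ⬝ᵥ u := by
  have h1 := dotProduct_sq_le u ((regGram x)⁻¹ *ᵥ u)
  have h2 := inv_mulVec_self_le_invForm x u
  have h3 := invForm_self_nonneg x u
  have h4 := dotProduct_self_nonneg' u
  change invForm x u u ^ 2 ≤ _ at h1
  by_contra! h
  nlinarith

theorem inv_mulVec_self_le (x : Fin k → Fin d → ℝ) (u : Fin d → ℝ) :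
    ((regGram x)⁻¹ *ᵥ u) ⬝ᵥ ((regGram x)⁻¹ *ᵥ u) ≤ u ⬝ᵥ u :=
  (inv_mulVec_self_le_invForm x u).trans (invForm_self_le x u)

theorem invForm_add_left (x : Fin k → Fin d → ℝ) (u v w : Fin d → ℝ) :
    invForm x (u + v) w = invForm x u w + invForm x v w := add_dotProduct _ _ _

theorem invForm_add_right (x : Fin k → Fin d → ℝ) (u v w : Fin d → ℝ) :
    invForm x u (v + w) = invForm x u v + invForm x u w := by
  rw [invForm, Matrix.mulVec_add, dotProduct_add]; rfl

theorem invForm_sub_right (x : Fin k → Fin d → ℝ) (u v w : Fin d → ℝ) :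
    invForm x u (v - w) = invForm x u v - invForm x u w := by
  rw [invForm, Matrix.mulVec_sub, dotProduct_sub]; rfl

theorem invForm_smul_right (x : Fin k → Fin d → ℝ) (a : ℝ) (u v : Fin d → ℝ) :
    invForm x u (a • v) = a * invForm x u v := by
  rw [invForm, Matrix.mulVec_smul, dotProduct_smul]; rfl

/-- Cauchy–Schwarz for the inverse form: the quadratic `t ↦ invForm x (u + t • v) (u + t • v)` is
nonnegative, hence has nonpositive discriminant. -/
theorem invForm_sq_le (x : Fin k → Fin d → ℝ) (u v : Fin d → ℝ) :
    invForm x u v ^ 2 ≤ invForm x u u * invForm x v v := by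
  have h : ∀ t : ℝ, 0 ≤ invForm x v v * (t * t) + 2 * invForm x u v * t + invForm x u u := by
    intro t
    have h0 := invForm_self_nonneg x (u + t • v)
    rw [invForm_add_right, invForm_smul_right, invForm_add_left, invForm_comm x (u + t • v) v,
      invForm_add_right, invForm_smul_right, invForm_comm x (t • v) u, invForm_smul_right,
      invForm_comm x v u] at h0
    linarith
  have := discrim_le_zero h
  unfold discrim at this
  linarith

theorem abs_invForm_le (x : Fin k → Fin d → ℝ) (u v : Fin d → ℝ) :
    |invForm x u v| ≤ √(invForm x u u) * √(invForm x v v) := by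
  rw [← Real.sqrt_mul (invForm_self_nonneg x u)]
  exact Real.abs_le_sqrt (invForm_sq_le x u v)

theorem abs_inv_regGram_apply_le (x : Fin k → Fin d → ℝ) (i j : Fin d) :
    |(regGram x)⁻¹ i j| ≤ 1 := by
  have h := inv_mulVec_self_le x (Pi.single j 1)
  rw [Matrix.mulVec_single_one] at h
  refine abs_apply_le_of_dotProduct_self_le (u := (regGram x)⁻¹.col j) zero_le_one ?_ i
  simpa using h

theorem regGram_snoc (x : Fin k → Fin d → ℝ) (u : Fin d → ℝ) :
    regGram (Fin.snoc (α := fun _ => Fin d → ℝ) x u) = regGram x + Matrix.vecMulVec u u := by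
  unfold regGram
  rw [Fin.sum_univ_castSucc]
  simp only [Fin.snoc_castSucc, Fin.snoc_last]
  abel

/-- The matrix determinant lemma for a rank-one update. It makes the log-determinant a potential
that grows by `log (1 + invForm x u u)` with each new vector. -/
theorem det_regGram_snoc (x : Fin k → Fin d → ℝ) (u : Fin d → ℝ) :
    (regGram (Fin.snoc (α := fun _ => Fin d → ℝ) x u)).det
      = (regGram x).det * (1 + invForm x u u) := by
  rw [regGram_snoc, Matrix.vecMulVec_eq Unit,
    Matrix.det_add_replicateCol_mul_replicateRow (isUnit_det_regGram x)]
  congr 1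
  rw [Matrix.det_unique, Matrix.add_apply, Matrix.one_apply_eq, Matrix.mul_assoc, ← Matrix.replicateCol_mulVec,
    Matrix.replicateRow_mul_replicateCol_apply]
  rfl

/-- One step of the elliptical potential argument. -/
theorem invForm_le_log_det (x : Fin k → Fin d → ℝ) {u : Fin d → ℝ} (hu : ∑ i, |u i| ≤ 1) :
    invForm x u u ≤ 2 * (Real.log (regGram (Fin.snoc (α := fun _ => Fin d → ℝ) x u)).det
      - Real.log (regGram x).det) := by
  have h0 := invForm_self_nonneg x u
  have h1 : invForm x u u ≤ 1 :=
    (invForm_self_le x u).trans ((dotProduct_self_le_sq hu).trans_eq (one_pow 2))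
  rw [det_regGram_snoc, Real.log_mul (det_regGram_pos x).ne' (by positivity), add_sub_cancel_left]
  have h2 := Real.one_sub_inv_le_log_of_pos (x := 1 + invForm x u u) (by positivity)
  have h3 : 1 - (1 + invForm x u u)⁻¹ = invForm x u u / (1 + invForm x u u) := by
    field_simp; ring
  have h4 : invForm x u u / 2 ≤ invForm x u u / (1 + invForm x u u) :=
    div_le_div_of_nonneg_left h0 (by positivity) (by linarith)
  linarith

theorem log_det_regGram_zero (x : Fin 0 → Fin d → ℝ) : Real.log (regGram x).det = 0 := by
  simp [regGram]

/-- Entries are at most `k + 1` in absolute value, so the Leibniz expansion gives at most `d! * (k +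
1) ^ d`. The extra factor `d` compared with a trace bound sits inside the logarithm and is harmless.
-/
theorem log_det_regGram_le (x : Fin k → Fin d → ℝ) (hx : ∀ i, ∑ j, |x i j| ≤ 1) :
    Real.log (regGram x).det ≤ d * Real.log (d * (k + 1)) := by
  have hx1 : ∀ i j, |x i j| ≤ 1 := fun i j =>
    (Finset.single_le_sum (f := fun j => |x i j|) (fun _ _ => abs_nonneg _)
      (Finset.mem_univ j)).trans (hx i)
  have hent : ∀ i j, AbsoluteValue.abs (regGram x i j) ≤ (k + 1 : ℝ) := fun i j => by
    rw [AbsoluteValue.abs_apply, regGram, Matrix.add_apply, Matrix.sum_apply]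
    refine (abs_add_le _ _).trans (add_le_add ?_ ?_)
    · refine (Finset.abs_sum_le_sum_abs _ _).trans ?_
      calc _ ≤ ∑ _l : Fin k, (1 : ℝ) := Finset.sum_le_sum fun l _ => by
            rw [Matrix.vecMulVec_apply, abs_mul]
            exact mul_le_one₀ (hx1 l i) (abs_nonneg _) (hx1 l j)
        _ = k := by simp
    · rw [Matrix.one_apply]; split_ifs <;> simp
  have h1 := Matrix.det_le hent
  rw [AbsoluteValue.abs_apply, abs_of_pos (det_regGram_pos x), Fintype.card_fin,
    nsmul_eq_mul] at h1
  have h2 : ((d.factorial : ℕ) : ℝ) ≤ (d : ℝ) ^ d := by exact_mod_cast d.factorial_le_pow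
  have h3 : (regGram x).det ≤ (d * (k + 1) : ℝ) ^ d := by
    rw [mul_pow]
    exact h1.trans (mul_le_mul_of_nonneg_right h2 (by positivity))
  rw [← Real.log_pow]
  exact Real.log_le_log (det_regGram_pos x) h3

end Gram

/-! ### Exponential supermartingales -/

section Concentration

/-- Stands in for Hoeffding's lemma: for centred `y` the linear term averages out, which leaves a
bound by the exponential of any bound on `y ^ 2`. -/
theorem exp_le_add_exp_sq (y : ℝ) : Real.exp y ≤ y + Real.exp (y ^ 2) := by
  have h2 := Real.add_one_le_exp (y ^ 2)
  rcases le_total |y| 1 with h | h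
  · have h1 := (abs_le.1 (Real.abs_exp_sub_one_sub_id_le h)).2
    linarith
  rcases le_total 0 y with hy | hy
  · rw [abs_of_nonneg hy] at h
    have : Real.exp y ≤ Real.exp (y ^ 2) := Real.exp_le_exp.2 (by nlinarith)
    linarith
  · rw [abs_of_nonpos hy] at h
    have : Real.exp y ≤ 1 := Real.exp_le_one_iff.2 hy
    nlinarith

variable [Fintype S]

/-- Deviation of the next-stage value `f` from its conditional expectation. -/
def noise (M : EpisodicMDP S A H) (h : Fin H) (f : S → ℝ) (τ : Trajectory S A H) : ℝ :=
  f (τ.1 h.succ) - nextMean M h f (τ.1 h.castSucc) (τ.2 h)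

theorem abs_nextMean_le (M : EpisodicMDP S A H) (h : Fin H) {f : S → ℝ} {b : ℝ}
    (hf : ∀ s, |f s| ≤ b) (s : S) (a : A) : |nextMean M h f s a| ≤ b :=
  (isProb_pmf _).abs_mean_le hf

theorem abs_noise_le (M : EpisodicMDP S A H) (h : Fin H) {f : S → ℝ} {b : ℝ}
    (hf : ∀ s, |f s| ≤ b) (τ : Trajectory S A H) : |noise M h f τ| ≤ 2 * b := by
  have h1 := hf (τ.1 h.succ)
  have h2 := abs_nextMean_le M h hf (τ.1 h.castSucc) (τ.2 h)
  refine (abs_sub _ _).trans ?_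
  linarith

variable [Fintype A]

/-- Given the state and action, the multiplier `t` is frozen and the noise is centred and bounded by
`2 * b`. The compensator `4 * b ^ 2 * t ^ 2` therefore dominates the square of the exponent, as
`exp_le_add_exp_sq` requires. -/
theorem mean_exp_noise_le (M : EpisodicMDP S A H) (ν : PMF S) (π : Policy S A H) (h : Fin H)
    {f : S → ℝ} {b : ℝ} (hf : ∀ s, |f s| ≤ b) (t : S → A → ℝ) :
    mean (trajProb M ν π) (fun τ => Real.exp (t (τ.1 h.castSucc) (τ.2 h) * noise M h f τ
      - 4 * b ^ 2 * t (τ.1 h.castSucc) (τ.2 h) ^ 2)) ≤ 1 := by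
  have := mean_trajProb_next M ν π h fun s a s' =>
    Real.exp (t s a * (f s' - nextMean M h f s a) - 4 * b ^ 2 * t s a ^ 2)
  simp only [noise]
  rw [this]
  refine (isProb_trajProb _ _ _).mean_le_of_le fun τ => ?_
  generalize τ.1 h.castSucc = s
  generalize τ.2 h = a
  have hp := isProb_pmf (M.trans h s a)
  have hb : ∀ s', (t s a * (f s' - nextMean M h f s a)) ^ 2 ≤ 4 * b ^ 2 * t s a ^ 2 := fun s' => by
    have h1 : |f s' - nextMean M h f s a| ≤ 2 * b := by
      have h2 := abs_nextMean_le M h hf s a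
      have h3 := hf s'
      refine (abs_sub _ _).trans ?_
      linarith
    have h4 : (f s' - nextMean M h f s a) ^ 2 ≤ (2 * b) ^ 2 := by
      rw [← sq_abs]; exact pow_le_pow_left₀ (abs_nonneg _) h1 2
    nlinarith [sq_nonneg (t s a)]
  calc nextMean M h (fun s' => Real.exp (t s a * (f s' - nextMean M h f s a)
        - 4 * b ^ 2 * t s a ^ 2)) s a
      ≤ mean (fun s' => (M.trans h s a s').toReal) fun s' =>
          Real.exp (-(4 * b ^ 2 * t s a ^ 2)) * (t s a * (f s' - nextMean M h f s a)
            + Real.exp (4 * b ^ 2 * t s a ^ 2)) := by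
        refine hp.mean_mono fun s' _ => ?_
        rw [sub_eq_neg_add, Real.exp_add]
        refine mul_le_mul_of_nonneg_left ((exp_le_add_exp_sq _).trans ?_) (Real.exp_nonneg _)
        exact add_le_add le_rfl (Real.exp_le_exp.2 (hb s'))
    _ = 1 := by
        rw [mean_const_mul, mean_add, mean_const_mul, mean_sub, hp.mean_const, hp.mean_const]
        have : mean (fun s' => (M.trans h s a s').toReal) f = nextMean M h f s a := rfl
        rw [this, sub_self, mul_zero, zero_add, ← Real.exp_add, neg_add_cancel, Real.exp_zero]

/-- Feature vector that a trajectory visits at stage `h`. -/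
def feat (φ : S → A → Fin d → ℝ) (h : Fin H) (τ : Trajectory S A H) : Fin d → ℝ :=
  φ (τ.1 h.castSucc) (τ.2 h)

/-- Exponent of the supermartingale in direction `x` for the next-stage value `f`. -/
def exponent (M : EpisodicMDP S A H) (φ : S → A → Fin d → ℝ) (h : Fin H) (b : ℝ)
    (x : Fin d → ℝ) (f : S → ℝ) {k : ℕ} (ω : Fin k → Trajectory S A H) : ℝ :=
  ∑ l, ((feat φ h (ω l) ⬝ᵥ x) * noise M h f (ω l) - 4 * b ^ 2 * (feat φ h (ω l) ⬝ᵥ x) ^ 2)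

/-- The exponential is a supermartingale started at one, whatever the adaptive policies `ϖ` are: a
new episode multiplies it by a factor of conditional mean at most one. -/
theorem pathMean_exp_exponent_le (M : EpisodicMDP S A H) (φ : S → A → Fin d → ℝ) (h : Fin H)
    (ϖ : (k : ℕ) → (Fin k → Trajectory S A H) → Policy S A H) {b : ℝ} {f : S → ℝ}
    (hf : ∀ s, |f s| ≤ b) (x : Fin d → ℝ) (k : ℕ) :
    pathMean (fun k ω => trajProb M M.init (ϖ k ω)) k
      (fun ω => Real.exp (exponent M φ h b x f ω)) ≤ 1 := by
  induction k with
  | zero => rw [pathMean_zero]; simp [exponent]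
  | succ k ih =>
    rw [pathMean_succ]
    refine le_trans ?_ ih
    refine (isProb_pathProb (fun k ω => isProb_trajProb _ _ _) k).mean_mono fun ω _ => ?_
    simp only [exponent, Fin.sum_univ_castSucc, Fin.snoc_castSucc, Fin.snoc_last, Real.exp_add]
    rw [mean_const_mul]
    exact mul_le_of_le_one_right (Real.exp_nonneg _)
      (mean_exp_noise_le M M.init (ϖ k ω) h hf fun s a => φ s a ⬝ᵥ x)

open Classical in
/-- Union bound over a finite family of directions and next-stage values. -/
theorem pathMean_exponent_exceeds_le {ι : Type*} (N : Finset ι) (M : EpisodicMDP S A H)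
    (φ : S → A → Fin d → ℝ) (ϖ : (k : ℕ) → (Fin k → Trajectory S A H) → Policy S A H)
    {b : ℝ} (h : ι → Fin H) (x : ι → Fin d → ℝ) (f : ι → S → ℝ) (hf : ∀ i s, |f i s| ≤ b)
    (L : ℝ) (k : ℕ) :
    pathMean (fun k ω => trajProb M M.init (ϖ k ω)) k
      (fun ω => if ∀ i ∈ N, exponent M φ (h i) b (x i) (f i) ω ≤ L then 0 else 1)
      ≤ N.card * Real.exp (-L) := by
  have hp := isProb_pathProb (T := Trajectory S A H)
    (κ := fun k ω => trajProb M M.init (ϖ k ω)) (fun k ω => isProb_trajProb _ _ _) k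
  calc _ ≤ pathMean (fun k ω => trajProb M M.init (ϖ k ω)) k
        (fun ω => ∑ i ∈ N, Real.exp (exponent M φ (h i) b (x i) (f i) ω) * Real.exp (-L)) := by
        refine hp.mean_mono fun ω _ => ?_
        split_ifs with hω
        · exact Finset.sum_nonneg fun i _ => by positivity
        · push Not at hω
          obtain ⟨i, hi, hL⟩ := hω
          refine le_trans ?_ (Finset.single_le_sum (f := fun i =>
            Real.exp (exponent M φ (h i) b (x i) (f i) ω) * Real.exp (-L))
            (fun i _ => by positivity) hi)
          rw [← Real.exp_add]
          exact Real.one_le_exp (by linarith)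
    _ = ∑ i ∈ N, pathMean (fun k ω => trajProb M M.init (ϖ k ω)) k
          (fun ω => Real.exp (exponent M φ (h i) b (x i) (f i) ω)) * Real.exp (-L) := by
        unfold pathMean
        rw [mean_sum]
        simp only [mean_mul_const]
    _ ≤ ∑ i ∈ N, 1 * Real.exp (-L) := Finset.sum_le_sum fun i _ =>
        mul_le_mul_of_nonneg_right (pathMean_exp_exponent_le M φ (h i) ϖ (hf i) (x i) k)
          (Real.exp_nonneg _)
    _ = N.card * Real.exp (-L) := by simp

end Concentration

/-! ### Grids -/

section Grid

/-- Integer vectors with entries in `[-B, B]`. -/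
def grid (ι : Type*) [Fintype ι] [DecidableEq ι] (B : ℕ) : Finset (ι → ℤ) :=
  Fintype.piFinset fun _ => Finset.Icc (-(B : ℤ)) B

theorem card_grid (ι : Type*) [Fintype ι] [DecidableEq ι] (B : ℕ) :
    (grid ι B).card = (2 * B + 1) ^ Fintype.card ι := by
  have : (((B : ℤ) + 1 - -(B : ℤ)).toNat) = 2 * B + 1 := by omega
  rw [sub_neg_eq_add] at this
  simp [grid, this]

/-- The point with coordinates `z i / m`. -/
def gridPoint {ι : Type*} (m : ℕ) (z : ι → ℤ) (i : ι) : ℝ := z i / m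

theorem exists_mem_grid {ι : Type*} [Fintype ι] [DecidableEq ι] {B m : ℕ} (hm : 0 < m) {a : ℝ}
    (hB : a * m ≤ B) {u : ι → ℝ} (hu : ∀ i, |u i| ≤ a) :
    ∃ z ∈ grid ι B, ∀ i, |u i - gridPoint m z i| ≤ 1 / m := by
  have hm' : (0 : ℝ) < m := by exact_mod_cast hm
  refine ⟨fun i => ⌊u i * m⌋, ?_, fun i => ?_⟩
  · refine Fintype.mem_piFinset.2 fun i => Finset.mem_Icc.2 ?_
    have h1 := abs_le.1 (hu i)
    have h2 : u i * m ≤ B := (mul_le_mul_of_nonneg_right h1.2 hm'.le).trans hB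
    have h3 : -(B : ℝ) ≤ u i * m := by
      have := mul_le_mul_of_nonneg_right h1.1 hm'.le
      linarith
    refine ⟨Int.le_floor.2 (by push_cast; exact h3), ?_⟩
    exact_mod_cast (Int.floor_le (u i * m)).trans h2
  · have h1 := Int.floor_le (u i * m)
    have h2 := Int.lt_floor_add_one (u i * m)
    have h3 : u i - gridPoint m (fun i => ⌊u i * m⌋) i = (u i * m - ⌊u i * m⌋) / m := by
      rw [gridPoint]; field_simp
    rw [h3, abs_div, abs_of_pos hm', abs_of_nonneg (by linarith)]
    exact div_le_div_of_nonneg_right (by linarith) hm'.le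

end Grid

/-! ### From finitely many directions to all directions -/

section SelfNormalized

variable [Fintype S]

/-- Noise vector of the regression of the next-stage value `f`. -/
def noiseSum (M : EpisodicMDP S A H) (φ : S → A → Fin d → ℝ) (h : Fin H) (f : S → ℝ) {k : ℕ}
    (ω : Fin k → Trajectory S A H) : Fin d → ℝ :=
  ∑ l, noise M h f (ω l) • feat φ h (ω l)

/-- The quadratic function `x ↦ ⟨x, u⟩ - 4 b² ⟨x, Λ x⟩` near its maximizer. -/
theorem quadratic_near_max {k : ℕ} (y : Fin k → Fin d → ℝ) {b : ℝ} (hb : 0 < b)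
    (u x : Fin d → ℝ) :
    x ⬝ᵥ u - 4 * b ^ 2 * (x ⬝ᵥ (regGram y *ᵥ x)) = invForm y u u / (16 * b ^ 2)
      - 4 * b ^ 2 * ((x - (8 * b ^ 2)⁻¹ • ((regGram y)⁻¹ *ᵥ u)) ⬝ᵥ
        (regGram y *ᵥ (x - (8 * b ^ 2)⁻¹ • ((regGram y)⁻¹ *ᵥ u)))) := by
  have h1 : ((regGram y)⁻¹ *ᵥ u) ⬝ᵥ (regGram y *ᵥ x) = x ⬝ᵥ u := by
    rw [dotProduct_regGram_mulVec]
    conv_rhs => rw [← regGram_mulVec_inv y u, dotProduct_regGram_mulVec]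
    rw [dotProduct_comm x]
    simp only [mul_comm]
  have h2 : ((regGram y)⁻¹ *ᵥ u) ⬝ᵥ u = invForm y u u := by
    rw [dotProduct_comm]; rfl
  rw [Matrix.mulVec_sub, Matrix.mulVec_smul, regGram_mulVec_inv]
  simp only [dotProduct_sub, sub_dotProduct, dotProduct_smul, smul_dotProduct, smul_eq_mul, h1, h2]
  field_simp
  ring

/-- The left side is, up to `16 * b ^ 2`, the maximum over `x` of the concave quadratic in
`quadratic_near_max`. Evaluating the exponent at a grid point next to the maximizer loses at most
one, so finitely many directions suffice. -/
theorem invForm_noiseSum_le (M : EpisodicMDP S A H) {φ : S → A → Fin d → ℝ}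
    (hφ : ∀ s a, ∑ i, |φ s a i| ≤ 1) (h : Fin H) {b : ℝ} (hb : 1 ≤ b) {f : S → ℝ}
    (hf : ∀ s, |f s| ≤ b) {k : ℕ} (ω : Fin k → Trajectory S A H) {B m : ℕ} (hm : 0 < m)
    (hB : (k : ℝ) * m ≤ B) (hkm : 4 * b ^ 2 * (k + d) ≤ (m : ℝ) ^ 2) {L : ℝ}
    (hL : ∀ z ∈ grid (Fin d) B, exponent M φ h b (gridPoint m z) f ω ≤ L) :
    invForm (fun l => feat φ h (ω l)) (noiseSum M φ h f ω) (noiseSum M φ h f ω)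
      ≤ 16 * b ^ 2 * (L + 1) := by
  set y : Fin k → Fin d → ℝ := fun l => feat φ h (ω l) with hy
  set u := noiseSum M φ h f ω with hu
  have hb0 : 0 < b := by linarith
  have hy1 : ∀ l, ∑ j, |y l j| ≤ 1 := fun l => hφ _ _
  have hu1 : ∑ j, |u j| ≤ k * (2 * b) := by
    have := sum_abs_sum_smul_le Finset.univ hy1 (y := fun l => noise M h f (ω l)) (a := 2 * b)
      fun l _ => abs_noise_le M h hf (ω l)
    simpa [noiseSum, hu, hy] using this
  -- The maximizer has length at most `k * (2 * b) / (8 * b ^ 2)`, hence lies in the box covered by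
  -- the grid.
  have hx : ∀ i, |((8 * b ^ 2)⁻¹ • ((regGram y)⁻¹ *ᵥ u)) i| ≤ (k : ℝ) := fun i => by
    have h1 := abs_apply_le_of_dotProduct_self_le (by positivity)
      ((inv_mulVec_self_le y u).trans (dotProduct_self_le_sq hu1)) i
    rw [Pi.smul_apply, smul_eq_mul, abs_mul, abs_of_pos (by positivity), inv_mul_le_iff₀
      (by positivity)]
    refine h1.trans ?_
    have : (0 : ℝ) ≤ k := by positivity
    nlinarith [mul_nonneg this hb0.le, mul_nonneg this (sub_nonneg.2 hb),
      mul_nonneg (mul_nonneg this hb0.le) (sub_nonneg.2 hb)]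
  obtain ⟨z, hz, hzx⟩ := exists_mem_grid hm hB hx
  have h1 := hL z hz
  set x := gridPoint m z with hxdef
  set δ := x - (8 * b ^ 2)⁻¹ • ((regGram y)⁻¹ *ᵥ u) with hδ
  have hδ1 : ∀ i, |δ i| ≤ 1 / m := fun i => by
    rw [hδ, Pi.sub_apply, abs_sub_comm]; exact hzx i
  have hm' : (0 : ℝ) < m := by exact_mod_cast hm
  have hq : δ ⬝ᵥ (regGram y *ᵥ δ) ≤ (k + d) / (m : ℝ) ^ 2 := by
    rw [dotProduct_regGram_mulVec]
    have h2 : ∑ l, (y l ⬝ᵥ δ) * (y l ⬝ᵥ δ) ≤ k * (1 / (m : ℝ)) ^ 2 := by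
      calc _ ≤ ∑ _l : Fin k, (1 / (m : ℝ)) ^ 2 := Finset.sum_le_sum fun l _ => by
            rw [← sq, ← sq_abs]
            exact pow_le_pow_left₀ (abs_nonneg _) (abs_dotProduct_le (hy1 l) hδ1 (by positivity)) 2
        _ = _ := by simp
    have h3 := dotProduct_self_le_of_abs_le hδ1
    calc _ ≤ k * (1 / (m : ℝ)) ^ 2 + d * (1 / (m : ℝ)) ^ 2 := add_le_add h2 h3
      _ = _ := by field_simp
  have hq2 : 4 * b ^ 2 * (δ ⬝ᵥ (regGram y *ᵥ δ)) ≤ 1 := by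
    calc _ ≤ 4 * b ^ 2 * ((k + d) / (m : ℝ) ^ 2) := mul_le_mul_of_nonneg_left hq (by positivity)
      _ = 4 * b ^ 2 * (k + d) / (m : ℝ) ^ 2 := by ring
      _ ≤ 1 := (div_le_one (by positivity)).2 hkm
  -- The exponent contains the Gram matrix without the identity. The discrepancy `4 * b ^ 2 * (x ⬝ᵥ
  -- x)` is nonnegative, so it helps and can be dropped.
  have hexp : exponent M φ h b x f ω = x ⬝ᵥ u - 4 * b ^ 2 * (x ⬝ᵥ (regGram y *ᵥ x))
      + 4 * b ^ 2 * (x ⬝ᵥ x) := by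
    rw [dotProduct_regGram_mulVec, exponent, Finset.sum_sub_distrib, hu, noiseSum, dotProduct_sum,
      ← Finset.mul_sum]
    have : ∀ l, x ⬝ᵥ noise M h f (ω l) • feat φ h (ω l)
        = (feat φ h (ω l) ⬝ᵥ x) * noise M h f (ω l) := fun l => by
      rw [dotProduct_smul, smul_eq_mul, dotProduct_comm, mul_comm]
    simp only [this, hy, sq]
    ring
  have hquad := quadratic_near_max y hb0 u x
  have hxx := dotProduct_self_nonneg' x
  rw [← hδ] at hquad
  have hfin : invForm y u u / (16 * b ^ 2) ≤ L + 1 := by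
    have : 0 ≤ 4 * b ^ 2 * (x ⬝ᵥ x) := by positivity
    linarith
  rwa [div_le_iff₀ (by positivity), mul_comm] at hfin

end SelfNormalized

/-! ### Truncation and greedy values -/

section Greedy

theorem clip_mono (b : ℝ) {x y : ℝ} (h : x ≤ y) : clip b x ≤ clip b y :=
  max_le_max le_rfl (min_le_min le_rfl h)

theorem clip_eq_self {b x : ℝ} (h : |x| ≤ b) : clip b x = x := by
  rw [clip, min_eq_right (abs_le.1 h).2, max_eq_right (abs_le.1 h).1]

theorem abs_clip_le {b : ℝ} (hb : 0 ≤ b) (x : ℝ) : |clip b x| ≤ b :=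
  abs_le.2 ⟨le_max_left _ _, max_le (by linarith) (min_le_left _ _)⟩

theorem abs_clip_sub_clip_le (b x y : ℝ) : |clip b x - clip b y| ≤ |x - y| := by
  unfold clip
  rw [max_comm (-b), max_comm (-b), min_comm b, min_comm b]
  refine (abs_max_sub_max_le_abs _ _ _).trans ((abs_min_sub_min_le_max _ _ _ _).trans ?_)
  simp

theorem sub_le_clip {b x y : ℝ} (hx : |x| ≤ b) (hy : 0 ≤ y) : x - y ≤ clip b (x - y) := by
  refine le_max_of_le_right (le_min ?_ le_rfl)
  linarith [(abs_le.1 hx).2]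

theorem abs_sqrt_sub_sqrt_le (x y : ℝ) : |√x - √y| ≤ √|x - y| := by
  have key : ∀ x y : ℝ, √x ≤ √y + √|x - y| := fun x y => by
    refine Real.sqrt_le_iff.2 ⟨by positivity, ?_⟩
    have h1 := Real.sq_sqrt (abs_nonneg (x - y))
    have h2 : y ≤ √y ^ 2 := by
      rcases le_total 0 y with h | h
      · rw [Real.sq_sqrt h]
      · exact h.trans (sq_nonneg _)
    nlinarith [le_abs_self (x - y), mul_nonneg (Real.sqrt_nonneg y) (Real.sqrt_nonneg |x - y|)]
  have h1 := key x y
  have h2 := key y x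
  rw [abs_sub_comm y x] at h2
  exact abs_le.2 ⟨by linarith, by linarith⟩

/-- A minimum is 1-Lipschitz in the sup norm, even though the minimizing action may jump. This is
why values are discretized and policies are not. -/
theorem abs_apply_argmin_sub_le {argmin : (A → ℝ) → A} (harg : ∀ (f : A → ℝ) (a : A),
    f (argmin f) ≤ f a) {f g : A → ℝ} {η : ℝ} (h : ∀ a, |f a - g a| ≤ η) :
    |f (argmin f) - g (argmin g)| ≤ η := by
  have h1 := harg f (argmin g)
  have h2 := harg g (argmin f)
  have h3 := abs_le.1 (h (argmin f))
  have h4 := abs_le.1 (h (argmin g))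
  exact abs_le.2 ⟨by linarith, by linarith⟩

/-- Truncated optimistic action value with linear part `u` and bonus matrix `Q`. -/
def optimisticQ (φ : S → A → Fin d → ℝ) (β b : ℝ) (u : Fin d → ℝ) (Q : Matrix (Fin d) (Fin d) ℝ)
    (s : S) (a : A) : ℝ :=
  clip b (φ s a ⬝ᵥ u - β * √(φ s a ⬝ᵥ (Q *ᵥ φ s a)))

/-- Value of the greedy action for `optimisticQ`. -/
def greedyValue (φ : S → A → Fin d → ℝ) (argmin : (A → ℝ) → A) (β b : ℝ) (u : Fin d → ℝ)
    (Q : Matrix (Fin d) (Fin d) ℝ) (s : S) : ℝ :=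
  optimisticQ φ β b u Q s (argmin (optimisticQ φ β b u Q s))

theorem abs_greedyValue_le (φ : S → A → Fin d → ℝ) (argmin : (A → ℝ) → A) (β : ℝ) {b : ℝ}
    (hb : 0 ≤ b) (u : Fin d → ℝ) (Q : Matrix (Fin d) (Fin d) ℝ) (s : S) :
    |greedyValue φ argmin β b u Q s| ≤ b := abs_clip_le hb _

/-- Truncation and minimization are 1-Lipschitz, but the square root in the bonus is only Hölder of
exponent one half. Parameters rounded to width `1 / R ^ 2` therefore give values accurate to order
`1 / R`. -/
theorem abs_greedyValue_sub_le {φ : S → A → Fin d → ℝ} (hφ : ∀ s a, ∑ i, |φ s a i| ≤ 1)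
    {argmin : (A → ℝ) → A} (harg : ∀ (f : A → ℝ) (a : A), f (argmin f) ≤ f a) {β : ℝ}
    (hβ : 0 ≤ β) (b : ℝ) {u u' : Fin d → ℝ} {Q Q' : Matrix (Fin d) (Fin d) ℝ} {R : ℕ} (hR : 0 < R)
    (hu : ∀ i, |u i - u' i| ≤ 1 / (R ^ 2 : ℕ)) (hQ : ∀ i j, |Q i j - Q' i j| ≤ 1 / (R ^ 2 : ℕ))
    (s : S) :
    |greedyValue φ argmin β b u Q s - greedyValue φ argmin β b u' Q' s| ≤ (1 + β) / R := by
  have hR1 : (1 : ℝ) ≤ R := by exact_mod_cast hR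
  have hR0 : (0 : ℝ) < R := by linarith
  refine abs_apply_argmin_sub_le harg fun a => (abs_clip_sub_clip_le _ _ _).trans ?_
  have h1 : |φ s a ⬝ᵥ u - φ s a ⬝ᵥ u'| ≤ 1 / (R ^ 2 : ℕ) := by
    rw [← dotProduct_sub]
    exact abs_dotProduct_le (hφ s a) hu (by positivity)
  have h2 : |φ s a ⬝ᵥ (Q *ᵥ φ s a) - φ s a ⬝ᵥ (Q' *ᵥ φ s a)| ≤ 1 / (R ^ 2 : ℕ) := by
    rw [← dotProduct_sub, ← Matrix.sub_mulVec]
    refine abs_dotProduct_le (hφ s a) (fun i => ?_) (by positivity)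
    rw [Matrix.mulVec, dotProduct_comm]
    exact abs_dotProduct_le (hφ s a) (fun j => hQ i j) (by positivity)
  have h3 : |√(φ s a ⬝ᵥ (Q *ᵥ φ s a)) - √(φ s a ⬝ᵥ (Q' *ᵥ φ s a))| ≤ 1 / R := by
    refine (abs_sqrt_sub_sqrt_le _ _).trans ((Real.sqrt_le_sqrt h2).trans_eq ?_)
    push_cast
    rw [Real.sqrt_div zero_le_one, Real.sqrt_one, Real.sqrt_sq hR0.le]
  have h4 : (1 : ℝ) / (R ^ 2 : ℕ) ≤ 1 / R := by
    refine one_div_le_one_div_of_le hR0 ?_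
    push_cast
    nlinarith
  calc _ = |(φ s a ⬝ᵥ u - φ s a ⬝ᵥ u')
        - β * (√(φ s a ⬝ᵥ (Q *ᵥ φ s a)) - √(φ s a ⬝ᵥ (Q' *ᵥ φ s a)))| := by ring_nf
    _ ≤ |φ s a ⬝ᵥ u - φ s a ⬝ᵥ u'|
        + |β * (√(φ s a ⬝ᵥ (Q *ᵥ φ s a)) - √(φ s a ⬝ᵥ (Q' *ᵥ φ s a)))| := abs_sub _ _
    _ ≤ 1 / R + β * (1 / R) := by
        rw [abs_mul, abs_of_nonneg hβ]
        exact add_le_add (h1.trans h4) (mul_le_mul_of_nonneg_left h3 hβ)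
    _ = (1 + β) / R := by ring

end Greedy

/-! ### The optimistic values of the algorithm -/

section Optimism

theorem vFun_last (I : Input S A d H) {k : ℕ} (ω : Fin k → Trajectory S A H)
    (w : Fin H → Fin d → ℝ) (s : S) : vFun I ω w (Fin.last H) s = 0 := by
  unfold vFun
  rw [Fin.reverseInduction_last]

theorem vFun_castSucc (I : Input S A d H) {k : ℕ} (ω : Fin k → Trajectory S A H)
    (w : Fin H → Fin d → ℝ) (h : Fin H) (s : S) :
    vFun I ω w h.castSucc s = qFun I ω w h s (I.argmin (qFun I ω w h s)) := by
  unfold qFun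
  conv_lhs => unfold vFun
  rw [Fin.reverseInduction_castSucc]
  rfl

theorem bonus_eq (I : Input S A d H) {k : ℕ} (ω : Fin k → Trajectory S A H) (h : Fin H) (s : S)
    (a : A) :
    bonus I ω h s a = I.β * √(invForm (fun l => feat I.φ h (ω l)) (I.φ s a) (I.φ s a)) := rfl

theorem qFun_eq_optimisticQ (I : Input S A d H) {k : ℕ} (ω : Fin k → Trajectory S A H)
    (w : Fin H → Fin d → ℝ) (h : Fin H) :
    qFun I ω w h = optimisticQ I.φ I.β ((H : ℝ) - (h : ℕ))
      (w h + ridge I ω h (vFun I ω w h.succ)) (gram I ω h)⁻¹ := by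
  funext s a
  rw [optimisticQ, dotProduct_add]
  rfl

theorem vFun_castSucc_eq_greedyValue (I : Input S A d H) {k : ℕ} (ω : Fin k → Trajectory S A H)
    (w : Fin H → Fin d → ℝ) (h : Fin H) (s : S) :
    vFun I ω w h.castSucc s = greedyValue I.φ I.argmin I.β ((H : ℝ) - (h : ℕ))
      (w h + ridge I ω h (vFun I ω w h.succ)) (gram I ω h)⁻¹ s := by
  rw [vFun_castSucc, qFun_eq_optimisticQ]
  rfl

theorem stage_sub_nonneg (h : Fin (H + 1)) : (0 : ℝ) ≤ (H : ℝ) - (h : ℕ) := by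
  have : ((h : ℕ) : ℝ) ≤ H := by exact_mod_cast h.is_le
  linarith

theorem abs_vFun_le (I : Input S A d H) {k : ℕ} (ω : Fin k → Trajectory S A H)
    (w : Fin H → Fin d → ℝ) (h : Fin (H + 1)) (s : S) :
    |vFun I ω w h s| ≤ (H : ℝ) - (h : ℕ) := by
  refine Fin.lastCases ?_ (fun h => ?_) h
  · simp [vFun_last]
  · rw [vFun_castSucc_eq_greedyValue]
    exact abs_greedyValue_le _ _ _ (stage_sub_nonneg h.castSucc) _ _ _

theorem abs_vFun_le_horizon (I : Input S A d H) {k : ℕ} (ω : Fin k → Trajectory S A H)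
    (w : Fin H → Fin d → ℝ) (h : Fin (H + 1)) (s : S) : |vFun I ω w h s| ≤ H := by
  have : (0 : ℝ) ≤ (h : ℕ) := by positivity
  linarith [abs_vFun_le I ω w h s]

theorem abs_ridge_le {I : Input S A d H} (hφ : ∀ s a, ∑ i, |I.φ s a i| ≤ 1) {k : ℕ}
    (ω : Fin k → Trajectory S A H) (h : Fin H) {V : S → ℝ} {b : ℝ} (hb : 0 ≤ b)
    (hV : ∀ s, |V s| ≤ b) (i : Fin d) : |ridge I ω h V i| ≤ k * b := by
  have h1 := sum_abs_sum_smul_le Finset.univ (x := fun l => feat I.φ h (ω l))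
    (fun l => hφ _ _) (y := fun l => V ((ω l).1 h.succ)) (a := b) fun l _ => hV _
  rw [Finset.card_univ, Fintype.card_fin] at h1
  exact abs_apply_le_of_dotProduct_self_le (by positivity)
    ((inv_mulVec_self_le (fun l => feat I.φ h (ω l)) _).trans (dotProduct_self_le_sq h1)) i

/-- The optimistic values lie within `(1 + β) / R` of a finite class that does not depend on
the data. -/
theorem exists_grid_near_vFun {I : Input S A d H} (hφ : ∀ s a, ∑ i, |I.φ s a i| ≤ 1)
    (harg : ∀ (f : A → ℝ) (a : A), f (I.argmin f) ≤ f a) (hβ : 0 ≤ I.β) {k : ℕ}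
    (ω : Fin k → Trajectory S A H) {w : Fin H → Fin d → ℝ} (hw : ∀ h i, |w h i| ≤ 1) {R B : ℕ}
    (hR : 0 < R) (hB : (k * H + 1 : ℝ) * (R ^ 2 : ℕ) ≤ B) (h : Fin (H + 1)) :
    ∃ p ∈ grid (Fin d) B, ∃ q ∈ grid (Fin d × Fin d) (R ^ 2), ∀ s,
      |vFun I ω w h s - greedyValue I.φ I.argmin I.β ((H : ℝ) - (h : ℕ)) (gridPoint (R ^ 2) p)
        (Matrix.of fun i j => gridPoint (R ^ 2) q (i, j)) s| ≤ (1 + I.β) / R := by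
  have hR0 : (0 : ℝ) < R := by exact_mod_cast hR
  refine Fin.lastCases ?_ (fun h => ?_) h
  -- At the final stage the truncation radius is zero, so any parameters reproduce the zero value
  -- exactly.
  · refine ⟨0, by simp [grid], 0, by simp [grid], fun s => ?_⟩
    have : ∀ x, clip 0 x = 0 := fun x => by simp [clip]
    simp only [vFun_last, Fin.val_last, sub_self, greedyValue, optimisticQ, this, abs_zero]
    positivity
  · have h1 : ∀ i, |(w h + ridge I ω h (vFun I ω w h.succ)) i| ≤ (k * H + 1 : ℝ) := fun i => by
      have h2 := abs_ridge_le hφ ω h (Nat.cast_nonneg H) (abs_vFun_le_horizon I ω w h.succ) i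
      refine (abs_add_le _ _).trans ?_
      linarith [hw h i]
    obtain ⟨p, hp, hp1⟩ := exists_mem_grid (pow_pos hR 2) hB h1
    have h3 : ∀ ij : Fin d × Fin d, |(gram I ω h)⁻¹ ij.1 ij.2| ≤ 1 := fun ij =>
      abs_inv_regGram_apply_le _ _ _
    obtain ⟨q, hq, hq1⟩ := exists_mem_grid (B := R ^ 2) (pow_pos hR 2) (by rw [one_mul]) h3
    refine ⟨p, hp, q, hq, fun s => ?_⟩
    rw [vFun_castSucc_eq_greedyValue]
    exact abs_greedyValue_sub_le hφ harg hβ _ hR hp1 (fun i j => hq1 (i, j)) s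

variable [Fintype S]

theorem sqrt_invForm_le {k : ℕ} (x : Fin k → Fin d → ℝ) {u : Fin d → ℝ} {a : ℝ} (ha : 0 ≤ a)
    (hu : u ⬝ᵥ u ≤ a ^ 2) : √(invForm x u u) ≤ a :=
  Real.sqrt_le_iff.2 ⟨ha, (invForm_self_le x u).trans hu⟩

/-- Error of the ridge regression of `V`, when the noise is controlled for a nearby `f`. -/
theorem abs_ridge_sub_nextMean_le {M : EpisodicMDP S A H} {I : Input S A d H}
    (hM : IsLinearMDP M I.φ) {k : ℕ} (ω : Fin k → Trajectory S A H) (h : Fin H) {V f : S → ℝ}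
    {b η E : ℝ} (hb : 0 ≤ b) (hV : ∀ s, |V s| ≤ b) (hVf : ∀ s, |V s - f s| ≤ η)
    (hη : k * (2 * η) ≤ 1) (hE : 0 ≤ E)
    (hS : invForm (fun l => feat I.φ h (ω l)) (noiseSum M I.φ h f ω) (noiseSum M I.φ h f ω)
      ≤ E ^ 2) (s : S) (a : A) :
    |I.φ s a ⬝ᵥ ridge I ω h V - nextMean M h V s a|
      ≤ √(invForm (fun l => feat I.φ h (ω l)) (I.φ s a) (I.φ s a)) * (E + 1 + √d * b) := by
  obtain ⟨hφ, m, hm, hP⟩ := hM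
  set y : Fin k → Fin d → ℝ := fun l => feat I.φ h (ω l) with hy
  -- Since the transitions factor through the features, the next-stage mean of any `V` is exactly
  -- linear with this weight vector.
  set θ : Fin d → ℝ := fun i => ∑ s', m h i s' * V s' with hθ
  have hnext : ∀ s a, nextMean M h V s a = I.φ s a ⬝ᵥ θ := fun s a => by
    simp only [nextMean, mean, hP, dotProduct, hθ, Finset.sum_mul, Finset.mul_sum]
    rw [Finset.sum_comm]
    exact Finset.sum_congr rfl fun i _ => Finset.sum_congr rfl fun s' _ => by ring
  have hθ1 : ∀ i, |θ i| ≤ b := fun i => by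
    calc |θ i| ≤ ∑ s', |m h i s' * V s'| := Finset.abs_sum_le_sum_abs _ _
      _ ≤ ∑ s', |m h i s'| * b := Finset.sum_le_sum fun s' _ => by
          rw [abs_mul]; exact mul_le_mul_of_nonneg_left (hV s') (abs_nonneg _)
      _ = (∑ s', |m h i s'|) * b := by rw [Finset.sum_mul]
      _ ≤ b := mul_le_of_le_one_left hb (hm h i)
  set D := noiseSum M I.φ h (fun s => V s - f s) ω with hD
  -- The regression targets are noise for the net member `f`, a rounding remainder `D`, and the
  -- signal. The leftover `- θ` is the ridge bias; these three sources give the summands `E`, `1`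
  -- and `√d * b`.
  have hsum : ∑ l, V ((ω l).1 h.succ) • feat I.φ h (ω l)
      = noiseSum M I.φ h f ω + D + regGram y *ᵥ θ - θ := by
    rw [regGram_mulVec, add_sub_assoc, add_sub_cancel_right, hD, noiseSum, noiseSum,
      ← Finset.sum_add_distrib, ← Finset.sum_add_distrib]
    refine Finset.sum_congr rfl fun l _ => ?_
    rw [← add_smul, ← add_smul]
    congr 1
    have h1 : nextMean M h (fun s => V s - f s) ((ω l).1 h.castSucc) ((ω l).2 h)
        = nextMean M h V ((ω l).1 h.castSucc) ((ω l).2 h)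
          - nextMean M h f ((ω l).1 h.castSucc) ((ω l).2 h) := mean_sub _ _ _
    have h2 : y l ⬝ᵥ θ = nextMean M h V ((ω l).1 h.castSucc) ((ω l).2 h) := (hnext _ _).symm
    rw [noise, noise, h1, h2]
    ring
  have hridge : I.φ s a ⬝ᵥ ridge I ω h V - nextMean M h V s a
      = invForm y (I.φ s a) (noiseSum M I.φ h f ω) + invForm y (I.φ s a) D
        - invForm y (I.φ s a) θ := by
    have h1 : I.φ s a ⬝ᵥ ridge I ω h V
        = invForm y (I.φ s a) (∑ l, V ((ω l).1 h.succ) • feat I.φ h (ω l)) := rfl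
    have h2 : invForm y (I.φ s a) (regGram y *ᵥ θ) = I.φ s a ⬝ᵥ θ := by
      rw [invForm, inv_regGram_mulVec]
    rw [h1, hsum, invForm_sub_right, invForm_add_right, invForm_add_right, h2, hnext]
    ring
  have hD1 : √(invForm y D D) ≤ 1 := by
    refine sqrt_invForm_le y zero_le_one (dotProduct_self_le_sq (le_trans ?_ hη))
    have := sum_abs_sum_smul_le Finset.univ (x := y) (fun l => hφ _ _)
      (y := fun l => noise M h (fun s => V s - f s) (ω l)) (a := 2 * η)
      fun l _ => abs_noise_le M h hVf (ω l)
    simpa [hD, noiseSum, hy] using this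
  have hθ2 : √(invForm y θ θ) ≤ √d * b := by
    refine sqrt_invForm_le y (by positivity) ?_
    rw [mul_pow, Real.sq_sqrt (Nat.cast_nonneg d)]
    exact dotProduct_self_le_of_abs_le hθ1
  have hS1 : √(invForm y (noiseSum M I.φ h f ω) (noiseSum M I.φ h f ω)) ≤ E :=
    Real.sqrt_le_iff.2 ⟨hE, hS⟩
  have hn := Real.sqrt_nonneg (invForm y (I.φ s a) (I.φ s a))
  rw [hridge]
  calc _ ≤ |invForm y (I.φ s a) (noiseSum M I.φ h f ω)| + |invForm y (I.φ s a) D|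
        + |invForm y (I.φ s a) θ| :=
        (abs_sub _ _).trans (add_le_add (abs_add_le _ _) le_rfl)
    _ ≤ √(invForm y (I.φ s a) (I.φ s a)) * E + √(invForm y (I.φ s a) (I.φ s a)) * 1
        + √(invForm y (I.φ s a) (I.φ s a)) * (√d * b) := by
        refine add_le_add (add_le_add ?_ ?_) ?_
        · exact (abs_invForm_le y _ _).trans (mul_le_mul_of_nonneg_left hS1 hn)
        · exact (abs_invForm_le y _ _).trans (mul_le_mul_of_nonneg_left hD1 hn)
        · exact (abs_invForm_le y _ _).trans (mul_le_mul_of_nonneg_left hθ2 hn)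
    _ = _ := by ring

/-- The bonus dominates the regression error of the optimistic values. -/
def IsAccurate (M : EpisodicMDP S A H) (I : Input S A d H) {k : ℕ} (ω : Fin k → Trajectory S A H)
    (w : Fin H → Fin d → ℝ) : Prop :=
  ∀ h s a, |I.φ s a ⬝ᵥ ridge I ω h (vFun I ω w h.succ) - nextMean M h (vFun I ω w h.succ) s a|
    ≤ bonus I ω h s a

section Accurate

variable {M : EpisodicMDP S A H} {I : Input S A d H} {k : ℕ} {ω : Fin k → Trajectory S A H}
  {w : Fin H → Fin d → ℝ}

theorem abs_cost_add_nextMean_le (hφ : ∀ s a, ∑ i, |I.φ s a i| ≤ 1) (hw : ∀ h i, |w h i| ≤ 1)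
    (h : Fin H) (s : S) (a : A) :
    |I.φ s a ⬝ᵥ w h + nextMean M h (vFun I ω w h.succ) s a| ≤ (H : ℝ) - (h : ℕ) := by
  have h1 := abs_dotProduct_le (hφ s a) (hw h) zero_le_one
  have h2 := abs_nextMean_le M h (abs_vFun_le I ω w h.succ) s a
  rw [Fin.val_succ] at h2
  push_cast at h2
  refine (abs_add_le _ _).trans ?_
  linarith

/-- The right side already lies in the truncation interval, so clipping fixes it, and monotonicity
of the clip transfers the untruncated inequality. -/
theorem IsAccurate.qFun_le (hacc : IsAccurate M I ω w) (hφ : ∀ s a, ∑ i, |I.φ s a i| ≤ 1)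
    (hw : ∀ h i, |w h i| ≤ 1) (h : Fin H) (s : S) (a : A) :
    qFun I ω w h s a ≤ I.φ s a ⬝ᵥ w h + nextMean M h (vFun I ω w h.succ) s a := by
  rw [← clip_eq_self (abs_cost_add_nextMean_le (M := M) (ω := ω) hφ hw h s a)]
  refine clip_mono _ ?_
  linarith [(abs_le.1 (hacc h s a)).2]

/-- Truncation at the lower end only raises a value, and truncation at the upper end cannot bite on
a number below the true backup; see `sub_le_clip`. -/
theorem IsAccurate.le_qFun (hacc : IsAccurate M I ω w) (hφ : ∀ s a, ∑ i, |I.φ s a i| ≤ 1)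
    (hw : ∀ h i, |w h i| ≤ 1) (h : Fin H) (s : S) (a : A) :
    I.φ s a ⬝ᵥ w h + nextMean M h (vFun I ω w h.succ) s a - 2 * bonus I ω h s a
      ≤ qFun I ω w h s a := by
  have h1 := hacc h s a
  refine (sub_le_clip (abs_cost_add_nextMean_le (M := M) (ω := ω) hφ hw h s a)
    (by linarith [(abs_nonneg _).trans h1])).trans (clip_mono _ ?_)
  linarith [(abs_le.1 h1).1]

theorem sum_sub_succ (g : Fin (H + 1) → ℝ) :
    ∑ h : Fin H, (g h.castSucc - g h.succ) = g 0 - g (Fin.last H) := by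
  have h1 := Fin.sum_univ_succ g
  have h2 := Fin.sum_univ_castSucc g
  rw [Finset.sum_sub_distrib]
  linarith

variable [Fintype A]

/-- By the Markov property the conditional mean of the next value may be replaced by the next value
itself, after which the sum telescopes. Both optimism and the bound for the greedy policy compare
stagewise costs with these differences. -/
theorem mean_sum_sub_nextMean (M : EpisodicMDP S A H) (ν : PMF S) (π : Policy S A H)
    (V : Fin (H + 1) → S → ℝ) :
    mean (trajProb M ν π) (fun τ => ∑ h : Fin H, (V h.castSucc (τ.1 h.castSucc)
      - nextMean M h (V h.succ) (τ.1 h.castSucc) (τ.2 h)))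
      = mean (trajProb M ν π) (fun τ => V 0 (τ.1 0) - V (Fin.last H) (τ.1 (Fin.last H))) := by
  have h1 : ∀ τ : Trajectory S A H, V 0 (τ.1 0) - V (Fin.last H) (τ.1 (Fin.last H))
      = ∑ h : Fin H, (V h.castSucc (τ.1 h.castSucc) - V h.succ (τ.1 h.succ)) := fun τ =>
    (sum_sub_succ fun h => V h (τ.1 h)).symm
  simp only [h1, mean_sum, mean_sub]
  refine Finset.sum_congr rfl fun h _ => ?_
  rw [mean_trajProb_next M ν π h fun _ _ s' => V h.succ s']

/-- The optimistic value is a lower bound for the cost of every policy. -/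
theorem IsAccurate.mean_vFun_le (hacc : IsAccurate M I ω w) (hφ : ∀ s a, ∑ i, |I.φ s a i| ≤ 1)
    (hw : ∀ h i, |w h i| ≤ 1) (harg : ∀ (f : A → ℝ) (a : A), f (I.argmin f) ≤ f a) (ν : PMF S)
    (π : Policy S A H) :
    mean (fun s => (ν s).toReal) (vFun I ω w 0)
      ≤ mean (trajProb M ν π) (totalCost fun h s a => I.φ s a ⬝ᵥ w h) := by
  have h1 := mean_sum_sub_nextMean M ν π (vFun I ω w)
  simp only [vFun_last, sub_zero] at h1
  rw [mean_trajProb_initial] at h1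
  rw [← h1]
  refine (isProb_trajProb _ _ _).mean_mono fun τ _ => Finset.sum_le_sum fun h _ => ?_
  rw [vFun_castSucc]
  have h2 := harg (qFun I ω w h (τ.1 h.castSucc)) (τ.2 h)
  have h3 := hacc.qFun_le hφ hw h (τ.1 h.castSucc) (τ.2 h)
  linarith

/-- The cost of the greedy policy exceeds the optimistic value by at most twice the bonuses. -/
theorem IsAccurate.mean_greedy_le (hacc : IsAccurate M I ω w) (hφ : ∀ s a, ∑ i, |I.φ s a i| ≤ 1)
    (hw : ∀ h i, |w h i| ≤ 1) (ν : PMF S) {π : Policy S A H}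
    (hπ : ∀ h s, π h s = PMF.pure (I.argmin (qFun I ω w h s))) :
    mean (trajProb M ν π) (totalCost fun h s a => I.φ s a ⬝ᵥ w h)
      ≤ mean (fun s => (ν s).toReal) (vFun I ω w 0)
        + 2 * mean (trajProb M ν π) (totalCost (bonus I ω)) := by
  have h1 := mean_sum_sub_nextMean M ν π (vFun I ω w)
  simp only [vFun_last, sub_zero] at h1
  rw [mean_trajProb_initial] at h1
  rw [← h1, ← mean_const_mul, ← mean_add]
  refine (isProb_trajProb _ _ _).mean_mono fun τ hτ => ?_
  simp only [totalCost]
  rw [Finset.mul_sum, ← Finset.sum_add_distrib]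
  refine Finset.sum_le_sum fun h _ => ?_
  -- Only trajectories of positive probability matter, and on these a deterministic policy has
  -- played the greedy action.
  have h2 : τ.2 h = I.argmin (qFun I ω w h (τ.1 h.castSucc)) := by
    have := policy_ne_zero_of_trajProb_ne_zero hτ h
    rw [hπ] at this
    simpa [PMF.mem_support_iff] using (PMF.mem_support_iff _ _).2 this
  rw [vFun_castSucc, ← h2]
  have h3 := hacc.le_qFun hφ hw h (τ.1 h.castSucc) (τ.2 h)
  linarith

end Accurate

end Optimism

/-! ### The finite family for the union bound -/

section UnionBound

/-- Indices of the union bound: a stage, a direction, and the parameters of a next-stage value. -/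
abbrev NetIndex (d H : ℕ) :=
  Fin H × (Fin d → ℤ) × (Fin d → ℤ) × (Fin d × Fin d → ℤ)

/-- The finite family for the union bound: directions up to `Bx`, linear parts up to `Bp` and
bonus matrices up to `R ^ 2`, in units of the grid width. -/
def net (d H Bx Bp R : ℕ) : Finset (NetIndex d H) :=
  Finset.univ ×ˢ grid (Fin d) Bx ×ˢ grid (Fin d) Bp ×ˢ grid (Fin d × Fin d) (R ^ 2)

theorem card_net (d H Bx Bp R : ℕ) : (net d H Bx Bp R).card
    = H * ((2 * Bx + 1) ^ d * ((2 * Bp + 1) ^ d * (2 * R ^ 2 + 1) ^ (d * d))) := by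
  simp [net, Finset.card_product, card_grid]

/-- Next-stage value that belongs to an index. -/
def netValue (I : Input S A d H) (R : ℕ) (i : NetIndex d H) : S → ℝ :=
  greedyValue I.φ I.argmin I.β ((H : ℝ) - (i.1.succ : ℕ)) (gridPoint (R ^ 2) i.2.2.1)
    (Matrix.of fun j l => gridPoint (R ^ 2) i.2.2.2 (j, l))

theorem abs_netValue_le (I : Input S A d H) (R : ℕ) (i : NetIndex d H) (s : S) :
    |netValue I R i s| ≤ H := by
  have h1 := abs_greedyValue_le I.φ I.argmin I.β (stage_sub_nonneg i.1.succ)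
    (gridPoint (R ^ 2) i.2.2.1) (Matrix.of fun j l => gridPoint (R ^ 2) i.2.2.2 (j, l)) s
  have h2 : (0 : ℝ) ≤ (i.1.succ : ℕ) := by positivity
  exact h1.trans (by linarith)

/-- All the exponents of the family are at most `L`. -/
def NetGood [Fintype S] (M : EpisodicMDP S A H) (I : Input S A d H) (m Bx Bp R : ℕ) (L : ℝ) {k : ℕ}
    (ω : Fin k → Trajectory S A H) : Prop :=
  ∀ i ∈ net d H Bx Bp R, exponent M I.φ i.1 H (gridPoint m i.2.1) (netValue I R i) ω ≤ L

/-- Compatibility of the parameters of the union bound with `K` episodes and bonus `β`. -/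
structure NetParams (d H K : ℕ) (β : ℝ) (m Bx Bp R : ℕ) (L : ℝ) : Prop where
  horizon_pos : 1 ≤ H
  m_pos : 0 < m
  R_pos : 0 < R
  L_nonneg : 0 ≤ L
  le_Bx : K * m ≤ Bx
  le_Bp : (K * H + 1) * R ^ 2 ≤ Bp
  le_m_sq : 4 * H ^ 2 * (K + d) ≤ m ^ 2
  le_R : 2 * K * (1 + β) ≤ R
  le_β : 4 * H * √(L + 1) + 1 + √d * H ≤ β

variable [Fintype S]

/-- The data-dependent value is rounded to a member of the fixed net, for which the noise bound
holds on the good event. The lower bound `le_β` then collects noise, rounding and ridge bias. The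
weights `w` may be arbitrary functions of the data, since the net does not involve them. -/
theorem NetGood.isAccurate {M : EpisodicMDP S A H} {I : Input S A d H} (hM : IsLinearMDP M I.φ)
    (harg : ∀ (f : A → ℝ) (a : A), f (I.argmin f) ≤ f a) {K m Bx Bp R : ℕ} {L : ℝ}
    (hpar : NetParams d H K I.β m Bx Bp R L) {k : ℕ} (hk : k ≤ K) {ω : Fin k → Trajectory S A H}
    (hω : NetGood M I m Bx Bp R L ω) {w : Fin H → Fin d → ℝ} (hw : ∀ h i, |w h i| ≤ 1) :
    IsAccurate M I ω w := by
  intro h s a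
  have hL := hpar.L_nonneg
  have hkK : (k : ℝ) ≤ K := by exact_mod_cast hk
  have hH : (1 : ℝ) ≤ H := by exact_mod_cast hpar.horizon_pos
  have hβ : 0 ≤ I.β := le_trans (by positivity) hpar.le_β
  have hR0 : (0 : ℝ) < R := by exact_mod_cast hpar.R_pos
  have hBp : (k * H + 1 : ℝ) * (R ^ 2 : ℕ) ≤ Bp := by
    have : (k * H + 1) * R ^ 2 ≤ Bp := le_trans (by gcongr) hpar.le_Bp
    exact_mod_cast this
  have hBx : (k : ℝ) * m ≤ Bx := by
    have : k * m ≤ Bx := le_trans (by gcongr) hpar.le_Bx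
    exact_mod_cast this
  have hm : 4 * (H : ℝ) ^ 2 * (k + d) ≤ (m : ℝ) ^ 2 := by
    have : 4 * H ^ 2 * (k + d) ≤ m ^ 2 := le_trans (by gcongr) hpar.le_m_sq
    exact_mod_cast this
  obtain ⟨p, hp, q, hq, hV⟩ := exists_grid_near_vFun hM.1 harg hβ ω hw hpar.R_pos hBp h.succ
  have hS := invForm_noiseSum_le M hM.1 h hH (abs_netValue_le I R (h, 0, p, q)) ω hpar.m_pos hBx
    hm (L := L) fun z hz => hω (h, z, p, q) (by simp [net, hz, hp, hq])
  have hη : (k : ℝ) * (2 * ((1 + I.β) / R)) ≤ 1 := by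
    have h1 : k * (2 * ((1 + I.β) / R)) = 2 * k * (1 + I.β) / R := by ring
    rw [h1, div_le_one hR0]
    exact le_trans (by gcongr) hpar.le_R
  have hE : 16 * (H : ℝ) ^ 2 * (L + 1) = (4 * H * √(L + 1)) ^ 2 := by
    rw [mul_pow, Real.sq_sqrt (by linarith)]; ring
  refine (abs_ridge_sub_nextMean_le hM ω h (Nat.cast_nonneg H) (abs_vFun_le_horizon I ω w h.succ)
    hV hη (by positivity) (hS.trans_eq hE) s a).trans ?_
  rw [bonus_eq, mul_comm]
  exact mul_le_mul_of_nonneg_right hpar.le_β (Real.sqrt_nonneg _)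

end UnionBound

/-! ### Regret of the optimistic policies for the cost weights in use -/

section OptimisticRegret

/-- AM–GM with a free parameter. Unlike Cauchy–Schwarz across episodes, it is linear in `y` and so
passes through all expectations; `r` is optimized only at the end. -/
theorem sqrt_le_of_pos {y r : ℝ} (hy : 0 ≤ y) (hr : 0 < r) : 2 * √y ≤ r * y + 1 / r := by
  have h1 := sq_nonneg (r * √y - 1)
  have h2 := Real.sq_sqrt hy
  have h3 : r * y + 1 / r - 2 * √y = (r * √y - 1) ^ 2 / r := by
    field_simp
    nlinarith
  have h4 : 0 ≤ (r * √y - 1) ^ 2 / r := div_nonneg h1 hr.le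
  linarith

/-- Sum over the stages of the log-determinants of the regularized Gram matrices. -/
def logDetSum (φ : S → A → Fin d → ℝ) {k : ℕ} (ω : Fin k → Trajectory S A H) : ℝ :=
  ∑ h : Fin H, Real.log (regGram fun l => feat φ h (ω l)).det

theorem feat_snoc (φ : S → A → Fin d → ℝ) (h : Fin H) {k : ℕ} (ω : Fin k → Trajectory S A H)
    (τ : Trajectory S A H) :
    (fun l => feat φ h (Fin.snoc (α := fun _ => Trajectory S A H) ω τ l))
      = Fin.snoc (α := fun _ => Fin d → ℝ) (fun l => feat φ h (ω l)) (feat φ h τ) := by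
  funext l
  refine Fin.lastCases ?_ (fun l => ?_) l <;> simp

theorem totalCost_bonus_le {I : Input S A d H} (hφ : ∀ s a, ∑ i, |I.φ s a i| ≤ 1) (hβ : 0 ≤ I.β)
    {r : ℝ} (hr : 0 < r) {k : ℕ} (ω : Fin k → Trajectory S A H) (τ : Trajectory S A H) :
    2 * totalCost (bonus I ω) τ ≤ I.β * H / r + 2 * I.β * r *
      (logDetSum I.φ (Fin.snoc (α := fun _ => Trajectory S A H) ω τ) - logDetSum I.φ ω) := by
  have h1 : I.β * H / r = ∑ _h : Fin H, I.β * (1 / r) := by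
    rw [Finset.sum_const, Finset.card_univ, Fintype.card_fin, nsmul_eq_mul]; ring
  rw [totalCost, Finset.mul_sum, logDetSum, logDetSum, ← Finset.sum_sub_distrib, Finset.mul_sum,
    h1, ← Finset.sum_add_distrib]
  refine Finset.sum_le_sum fun h _ => ?_
  have h2 := sqrt_le_of_pos (invForm_self_nonneg (fun l => feat I.φ h (ω l)) (feat I.φ h τ)) hr
  have h3 := invForm_le_log_det (fun l => feat I.φ h (ω l)) (u := feat I.φ h τ) (hφ _ _)
  rw [bonus_eq, feat_snoc]
  have h4 := mul_le_mul_of_nonneg_left h2 hβ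
  have h5 := mul_le_mul_of_nonneg_left h3 (mul_nonneg hβ hr.le)
  change 2 * (I.β * √(invForm _ (feat I.φ h τ) (feat I.φ h τ))) ≤ _
  linarith

theorem logDetSum_snoc_ge {φ : S → A → Fin d → ℝ} (hφ : ∀ s a, ∑ i, |φ s a i| ≤ 1) {k : ℕ}
    (ω : Fin k → Trajectory S A H) (τ : Trajectory S A H) :
    logDetSum φ ω ≤ logDetSum φ (Fin.snoc (α := fun _ => Trajectory S A H) ω τ) := by
  refine Finset.sum_le_sum fun h _ => ?_
  have h3 := invForm_le_log_det (fun l => feat φ h (ω l)) (u := feat φ h τ) (hφ _ _)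
  have h4 := invForm_self_nonneg (fun l => feat φ h (ω l)) (feat φ h τ)
  rw [feat_snoc]
  linarith

variable [Fintype S] [Fintype A]

theorem abs_mean_totalCost_le (M : EpisodicMDP S A H) (ν : PMF S) (π : Policy S A H)
    {c : Fin H → S → A → ℝ} (hc : ∀ h s a, |c h s a| ≤ 1) :
    |mean (trajProb M ν π) (totalCost c)| ≤ H := by
  refine (isProb_trajProb _ _ _).abs_mean_le fun τ => (Finset.abs_sum_le_sum_abs _ _).trans ?_
  refine (Finset.sum_le_sum fun h _ => hc h _ _).trans_eq ?_
  simp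

theorem gap_le (M : EpisodicMDP S A H) (π π' : Policy S A H) {c : Fin H → S → A → ℝ}
    (hc : ∀ h s a, |c h s a| ≤ 1) : gap M c π π' ≤ 2 * H := by
  rw [gap_eq]
  have h1 := abs_le.1 (abs_mean_totalCost_le M M.init π hc)
  have h2 := abs_le.1 (abs_mean_totalCost_le M M.init π' hc)
  linarith

variable [Nonempty A]

/-- Law of the next episode of BRIG given the past ones. -/
def episodeLaw (M : EpisodicMDP S A H) (I : Input S A d H) (e : Fin H → Fin d → ℝ) (k : ℕ)
    (ω : Fin k → Trajectory S A H) : Trajectory S A H → ℝ :=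
  trajProb M M.init (policy I e k ω)

theorem isProb_episodeLaw (M : EpisodicMDP S A H) (I : Input S A d H) (e : Fin H → Fin d → ℝ)
    (k : ℕ) (ω : Fin k → Trajectory S A H) : IsProb (episodeLaw M I e k ω) :=
  isProb_trajProb _ _ _

/-- Expected log-determinant potential after `k` episodes. -/
def meanLogDet (M : EpisodicMDP S A H) (I : Input S A d H) (e : Fin H → Fin d → ℝ) (k : ℕ) : ℝ :=
  pathMean (episodeLaw M I e) k (logDetSum I.φ)

theorem meanLogDet_zero (M : EpisodicMDP S A H) (I : Input S A d H) (e : Fin H → Fin d → ℝ) :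
    meanLogDet M I e 0 = 0 := by
  rw [meanLogDet, pathMean_zero, logDetSum]
  exact Finset.sum_eq_zero fun h _ => log_det_regGram_zero _

theorem meanLogDet_le (M : EpisodicMDP S A H) {I : Input S A d H}
    (hφ : ∀ s a, ∑ i, |I.φ s a i| ≤ 1) (e : Fin H → Fin d → ℝ) (k : ℕ) :
    meanLogDet M I e k ≤ H * (d * Real.log (d * (k + 1))) := by
  refine (isProb_pathProb (isProb_episodeLaw M I e) k).mean_le_of_le fun ω => ?_
  calc logDetSum I.φ ω ≤ ∑ _h : Fin H, d * Real.log (d * (k + 1)) :=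
        Finset.sum_le_sum fun h _ => log_det_regGram_le _ fun l => hφ _ _
    _ = _ := by simp

theorem meanLogDet_mono (M : EpisodicMDP S A H) {I : Input S A d H}
    (hφ : ∀ s a, ∑ i, |I.φ s a i| ≤ 1) (e : Fin H → Fin d → ℝ) (k : ℕ) :
    meanLogDet M I e k ≤ meanLogDet M I e (k + 1) := by
  rw [meanLogDet, meanLogDet, pathMean_succ]
  refine (isProb_pathProb (isProb_episodeLaw M I e) k).mean_mono fun ω _ => ?_
  exact (isProb_episodeLaw M I e k ω).le_mean_of_le fun τ => logDetSum_snoc_ge hφ ω τ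

/-- The linear cost with the weights that BRIG uses after the episodes `ω`. -/
def currentCost (I : Input S A d H) (e : Fin H → Fin d → ℝ) {k : ℕ}
    (ω : Fin k → Trajectory S A H) : Fin H → S → A → ℝ :=
  fun h s a => I.φ s a ⬝ᵥ costWeight I e k ω h

/-- The optimistic value sits below the expert's cost and, up to twice the bonuses, above that of
the greedy policy, so it cancels. The bonuses are averaged over the law of the very next episode,
which turns them into an expected increment of `logDetSum`. -/
theorem gap_currentCost_le_of_isAccurate {M : EpisodicMDP S A H} {I : Input S A d H}
    (hφ : ∀ s a, ∑ i, |I.φ s a i| ≤ 1) (harg : ∀ (f : A → ℝ) (a : A), f (I.argmin f) ≤ f a)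
    (hβ : 0 ≤ I.β) {r : ℝ} (hr : 0 < r) (e : Fin H → Fin d → ℝ) {k : ℕ}
    {ω : Fin (k + 1) → Trajectory S A H}
    (hw : ∀ h i, |costWeight I e (k + 1) ω h i| ≤ 1)
    (hacc : IsAccurate M I ω (costWeight I e (k + 1) ω)) (πE : Policy S A H) :
    gap M (currentCost I e ω) (policy I e (k + 1) ω) πE ≤ I.β * H / r + 2 * I.β * r *
      (mean (episodeLaw M I e (k + 1) ω) (fun τ =>
        logDetSum I.φ (Fin.snoc (α := fun _ => Trajectory S A H) ω τ)) - logDetSum I.φ ω) := by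
  have h1 := hacc.mean_vFun_le hφ hw harg M.init πE
  have h2 := hacc.mean_greedy_le hφ hw M.init (π := policy I e (k + 1) ω) fun h s => rfl
  have hp := isProb_episodeLaw M I e (k + 1) ω
  have h3 : 2 * mean (episodeLaw M I e (k + 1) ω) (totalCost (bonus I ω))
      ≤ I.β * H / r + 2 * I.β * r * (mean (episodeLaw M I e (k + 1) ω) (fun τ =>
        logDetSum I.φ (Fin.snoc (α := fun _ => Trajectory S A H) ω τ)) - logDetSum I.φ ω) := by
    rw [← mean_const_mul]
    refine (hp.mean_mono fun τ _ => totalCost_bonus_le hφ hβ hr ω τ).trans_eq ?_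
    rw [mean_add, hp.mean_const, mean_const_mul, mean_sub, hp.mean_const]
  rw [gap_eq]
  unfold episodeLaw at h3 ⊢
  change mean _ (totalCost fun h s a => I.φ s a ⬝ᵥ costWeight I e (k + 1) ω h)
    - mean _ (totalCost fun h s a => I.φ s a ⬝ᵥ costWeight I e (k + 1) ω h) ≤ _
  linarith

/-- On the good event the optimistic bound applies; off it the trivial bound `2 * H` is weighted by
the failure probability from the union bound. A separate event for each episode suffices because
expectations add. -/
theorem pathMean_gap_currentCost_le {M : EpisodicMDP S A H} {I : Input S A d H}
    (hM : IsLinearMDP M I.φ) (harg : ∀ (f : A → ℝ) (a : A), f (I.argmin f) ≤ f a)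
    {K m Bx Bp R : ℕ} {L : ℝ} (hpar : NetParams d H K I.β m Bx Bp R L) {r : ℝ} (hr : 0 < r)
    (e : Fin H → Fin d → ℝ)
    (hw : ∀ k (ω : Fin k → Trajectory S A H) h i, |costWeight I e k ω h i| ≤ 1)
    (πE : Policy S A H) {k : ℕ} (hk : k + 1 ≤ K) :
    pathMean (episodeLaw M I e) (k + 1)
        (fun ω => gap M (currentCost I e ω) (policy I e (k + 1) ω) πE)
      ≤ 2 * H * ((net d H Bx Bp R).card * Real.exp (-L)) + I.β * H / r + 2 * I.β * r *
        (meanLogDet M I e (k + 2) - meanLogDet M I e (k + 1)) := by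
  classical
  have hβ : 0 ≤ I.β := by
    have := hpar.L_nonneg
    exact le_trans (by positivity) hpar.le_β
  have hp := isProb_pathProb (isProb_episodeLaw M I e) (k + 1)
  have hbad := pathMean_exponent_exceeds_le (net d H Bx Bp R) M I.φ (policy I e) (fun i => i.1)
    (fun i => gridPoint m i.2.1) (netValue I R) (abs_netValue_le I R) L (k + 1)
  have hexp : meanLogDet M I e (k + 2) = pathMean (episodeLaw M I e) (k + 1) fun ω =>
      mean (episodeLaw M I e (k + 1) ω) fun τ =>
        logDetSum I.φ (Fin.snoc (α := fun _ => Trajectory S A H) ω τ) := pathMean_succ _ _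
  have hH : (0 : ℝ) ≤ 2 * H := by positivity
  refine le_trans ?_ (add_le_add (add_le_add (mul_le_mul_of_nonneg_left hbad hH) le_rfl) le_rfl)
  rw [hexp, meanLogDet]
  unfold pathMean
  rw [← mean_sub, ← mean_const_mul, ← mean_const_mul, ← hp.mean_const (I.β * H / r)]
  refine le_trans ?_ (le_of_eq (congrArg₂ (· + ·) (mean_add _ _ _) rfl))
  refine le_trans ?_ (le_of_eq (mean_add _ _ _))
  refine hp.mean_mono fun ω _ => ?_
  have hmono : 0 ≤ 2 * I.β * r * (mean (episodeLaw M I e (k + 1) ω) (fun τ =>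
      logDetSum I.φ (Fin.snoc (α := fun _ => Trajectory S A H) ω τ)) - logDetSum I.φ ω) :=
    mul_nonneg (by positivity) (sub_nonneg.2
      ((isProb_episodeLaw M I e _ ω).le_mean_of_le fun τ => logDetSum_snoc_ge hM.1 ω τ))
  split_ifs with hω
  · have hacc := NetGood.isAccurate hM harg hpar hk hω (hw _ ω)
    have := gap_currentCost_le_of_isAccurate hM.1 harg hβ hr e (hw _ ω) hacc πE
    linarith
  · have h1 := gap_le M (policy I e (k + 1) ω) πE (c := currentCost I e ω) fun h s a =>
      abs_dotProduct_le (hM.1 s a) (hw _ ω h) zero_le_one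
    have h2 : 0 ≤ I.β * H / r := by positivity
    linarith

theorem sum_pathMean_gap_currentCost_le {M : EpisodicMDP S A H} {I : Input S A d H}
    (hM : IsLinearMDP M I.φ) (harg : ∀ (f : A → ℝ) (a : A), f (I.argmin f) ≤ f a)
    {K m Bx Bp R : ℕ} {L : ℝ} (hpar : NetParams d H K I.β m Bx Bp R L) {r : ℝ} (hr : 0 < r)
    (e : Fin H → Fin d → ℝ)
    (hw : ∀ k (ω : Fin k → Trajectory S A H) h i, |costWeight I e k ω h i| ≤ 1)
    (πE : Policy S A H) :
    ∑ k ∈ Finset.range K, pathMean (episodeLaw M I e) k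
        (fun ω => gap M (currentCost I e ω) (policy I e k ω) πE)
      ≤ 2 * H + K * (2 * H * ((net d H Bx Bp R).card * Real.exp (-L)) + I.β * H / r)
        + 2 * I.β * r * (H * (d * Real.log (d * (K + 1)))) := by
  have hβ : 0 ≤ I.β := by
    have := hpar.L_nonneg
    exact le_trans (by positivity) hpar.le_β
  suffices h : ∀ n ≤ K, ∑ k ∈ Finset.range n, pathMean (episodeLaw M I e) k
        (fun ω => gap M (currentCost I e ω) (policy I e k ω) πE)
      ≤ 2 * H + n * (2 * H * ((net d H Bx Bp R).card * Real.exp (-L)) + I.β * H / r)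
        + 2 * I.β * r * meanLogDet M I e n by
    refine (h K le_rfl).trans (add_le_add le_rfl ?_)
    exact mul_le_mul_of_nonneg_left (meanLogDet_le M hM.1 e K) (by positivity)
  intro n hn
  induction n with
  | zero => simp [meanLogDet_zero]
  | succ n ih =>
    rw [Finset.sum_range_succ]
    -- The first policy is uniform rather than greedy, so it is charged the trivial `2 * H`; its
    -- potential increment is nonnegative and can be added for free.
    cases n with
    | zero =>
      have h1 : pathMean (episodeLaw M I e) 0
          (fun ω => gap M (currentCost I e ω) (policy I e 0 ω) πE) ≤ 2 * H := by
        rw [pathMean_zero]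
        exact gap_le M _ πE (c := currentCost I e _) fun h s a =>
          abs_dotProduct_le (hM.1 s a) (hw _ _ h) zero_le_one
      have h2 := meanLogDet_mono M hM.1 e 0
      rw [meanLogDet_zero] at h2
      have h3 : 0 ≤ 2 * I.β * r * meanLogDet M I e (0 + 1) := by positivity
      have h4 : 0 ≤ ((0 + 1 : ℕ) : ℝ) * (2 * H * ((net d H Bx Bp R).card * Real.exp (-L))
        + I.β * H / r) := by positivity
      rw [Finset.sum_range_zero]
      linarith
    | succ n =>
      have h1 := ih (by omega)
      have h2 := pathMean_gap_currentCost_le hM harg hpar hr e hw πE (k := n) (by omega)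
      push_cast at h1 ⊢
      have e1 : n + 1 + 1 = n + 2 := rfl
      rw [e1]
      linarith

end OptimisticRegret

/-! ### Euclidean projection -/

section Projection

theorem exists_isProj {W : Set (Fin d → ℝ)} (hcl : IsClosed W) (hbd : ∀ w ∈ W, ∀ i, |w i| ≤ 1)
    (hne : W.Nonempty) (x : Fin d → ℝ) : ∃ y, IsProj W x y := by
  have hsub : W ⊆ Metric.closedBall 0 1 := fun w hw => by
    rw [mem_closedBall_zero_iff, pi_norm_le_iff_of_nonneg zero_le_one]
    exact hbd w hw
  have hcomp : IsCompact W := (isCompact_closedBall _ _).of_isClosed_subset hcl hsub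
  obtain ⟨y, hy, hmin⟩ := hcomp.exists_isMinOn hne
    (f := fun z => (x - z) ⬝ᵥ (x - z)) (Continuous.continuousOn (by unfold dotProduct; fun_prop))
  exact ⟨y, hy, fun z hz => hmin hz⟩

theorem isProj_proj {W : Set (Fin d → ℝ)} (hcl : IsClosed W) (hbd : ∀ w ∈ W, ∀ i, |w i| ≤ 1)
    (hne : W.Nonempty) (x : Fin d → ℝ) : IsProj W x (proj W x) := by
  have h := exists_isProj hcl hbd hne x
  rw [proj, dif_pos h]
  exact h.choose_spec

theorem sub_smul_dotProduct_self (u v : Fin d → ℝ) (t : ℝ) :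
    (u - t • v) ⬝ᵥ (u - t • v) = u ⬝ᵥ u - 2 * t * (u ⬝ᵥ v) + t ^ 2 * (v ⬝ᵥ v) := by
  simp only [dotProduct_sub, sub_dotProduct, dotProduct_smul, smul_dotProduct, smul_eq_mul,
    dotProduct_comm v u]
  ring

/-- If the angle were acute, a small move from `y` towards `z` would stay in `W` and come closer to
`x`. -/
theorem IsProj.dotProduct_le {W : Set (Fin d → ℝ)} (hconv : Convex ℝ W) {x y z : Fin d → ℝ}
    (hy : IsProj W x y) (hz : z ∈ W) : (x - y) ⬝ᵥ (z - y) ≤ 0 := by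
  by_contra! hpos
  set a := (x - y) ⬝ᵥ (z - y) with ha
  set b := (z - y) ⬝ᵥ (z - y) with hb
  have hb0 : 0 ≤ b := dotProduct_self_nonneg' _
  have key : ∀ t : ℝ, 0 ≤ t → t ≤ 1 → 2 * t * a ≤ t ^ 2 * b := fun t h0 h1 => by
    have hmem : y + t • (z - y) ∈ W := hconv.add_smul_sub_mem hy.1 hz ⟨h0, h1⟩
    have h2 := hy.2 _ hmem
    have e : x - (y + t • (z - y)) = (x - y) - t • (z - y) := by abel
    rw [e] at h2
    have h3 := sub_smul_dotProduct_self (x - y) (z - y) t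
    linarith
  have hpos' : 0 < a + b := by linarith
  -- This step length lies in `[0, 1]` without case distinction and still makes the linear gain
  -- exceed the quadratic loss.
  have h1 := key (a / (a + b)) (by positivity) ((div_le_one hpos').2 (by linarith))
  have h2 : 2 * (a / (a + b)) * a = 2 * a ^ 2 / (a + b) := by ring
  have h3 : (a / (a + b)) ^ 2 * b = a ^ 2 / (a + b) * (b / (a + b)) := by ring
  have h4 : b / (a + b) ≤ 1 := (div_le_one hpos').2 (by linarith)
  have h5 : 0 < a ^ 2 / (a + b) := by positivity
  have h6 : 2 * a ^ 2 / (a + b) = 2 * (a ^ 2 / (a + b)) := by ring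
  nlinarith

theorem IsProj.dist_sq_le {W : Set (Fin d → ℝ)} (hconv : Convex ℝ W) {x y z : Fin d → ℝ}
    (hy : IsProj W x y) (hz : z ∈ W) : (y - z) ⬝ᵥ (y - z) ≤ (x - z) ⬝ᵥ (x - z) := by
  have h1 := hy.dotProduct_le hconv hz
  have h2 : (x - z) ⬝ᵥ (x - z)
      = (x - y) ⬝ᵥ (x - y) - 2 * ((x - y) ⬝ᵥ (z - y)) + (y - z) ⬝ᵥ (y - z) := by
    have e : x - z = (x - y) + (y - z) := by abel
    have e2 : z - y = -(y - z) := by abel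
    rw [e, e2, dotProduct_add, add_dotProduct, add_dotProduct, dotProduct_neg,
      dotProduct_comm (y - z) (x - y)]
    ring
  have h3 := dotProduct_self_nonneg' (x - y)
  linarith

end Projection

/-! ### Online gradient descent on the cost weights -/

section CostWeights

theorem costWeight_snoc (I : Input S A d H) (e : Fin H → Fin d → ℝ) {k : ℕ}
    (ω : Fin k → Trajectory S A H) (τ : Trajectory S A H) (h : Fin H) :
    costWeight I e (k + 1) (Fin.snoc (α := fun _ => Trajectory S A H) ω τ) h
      = proj I.W (costWeight I e k ω h - I.α • (e h - feat I.φ h τ)) := by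
  rw [costWeight, Fin.init_snoc, Fin.snoc_last]
  rfl

theorem costWeight_mem {I : Input S A d H} (hcl : IsClosed I.W)
    (hbd : ∀ w ∈ I.W, ∀ i, |w i| ≤ 1) (hw₁ : ∀ h, I.w₁ h ∈ I.W) (e : Fin H → Fin d → ℝ) (k : ℕ)
    (ω : Fin k → Trajectory S A H) (h : Fin H) : costWeight I e k ω h ∈ I.W := by
  cases k with
  | zero => exact hw₁ h
  | succ k => exact (isProj_proj hcl hbd ⟨_, hw₁ h⟩ _).1

/-- Projection does not increase the distance to a point of `W`, so it is enough to expand the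
square of the unprojected step. The gradient is a difference of vectors of `ℓ¹` norm at most one,
hence the constant `4`. -/
theorem costWeight_step {I : Input S A d H} (hφ : ∀ s a, ∑ i, |I.φ s a i| ≤ 1) (hcl : IsClosed I.W)
    (hconv : Convex ℝ I.W) (hbd : ∀ w ∈ I.W, ∀ i, |w i| ≤ 1) {e : Fin H → Fin d → ℝ}
    (he : ∀ h, ∑ i, |e h i| ≤ 1) {k : ℕ} (ω : Fin k → Trajectory S A H) (τ : Trajectory S A H)
    (h : Fin H) {w : Fin d → ℝ} (hw : w ∈ I.W) :
    2 * I.α * ((e h - feat I.φ h τ) ⬝ᵥ (costWeight I e k ω h - w))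
      ≤ (costWeight I e k ω h - w) ⬝ᵥ (costWeight I e k ω h - w)
        - (costWeight I e (k + 1) (Fin.snoc (α := fun _ => Trajectory S A H) ω τ) h - w) ⬝ᵥ
          (costWeight I e (k + 1) (Fin.snoc (α := fun _ => Trajectory S A H) ω τ) h - w)
        + 4 * I.α ^ 2 := by
  rw [costWeight_snoc]
  set v := costWeight I e k ω h
  set g := e h - feat I.φ h τ with hg
  have h1 := (isProj_proj hcl hbd ⟨w, hw⟩ (v - I.α • g)).dist_sq_le hconv hw
  have h2 : (v - I.α • g - w) ⬝ᵥ (v - I.α • g - w)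
      = (v - w) ⬝ᵥ (v - w) - 2 * I.α * (g ⬝ᵥ (v - w)) + I.α ^ 2 * (g ⬝ᵥ g) := by
    have e1 : v - I.α • g - w = (v - w) - I.α • g := by abel
    rw [e1, sub_smul_dotProduct_self, dotProduct_comm (v - w) g]
  have h3 : g ⬝ᵥ g ≤ 2 ^ 2 := by
    refine dotProduct_self_le_sq ?_
    calc ∑ i, |g i| ≤ ∑ i, (|e h i| + |feat I.φ h τ i|) :=
          Finset.sum_le_sum fun i _ => abs_sub _ _
      _ ≤ 2 := by
          rw [Finset.sum_add_distrib]
          have := hφ (τ.1 h.castSucc) (τ.2 h)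
          unfold feat
          linarith [he h]
  have h4 := mul_le_mul_of_nonneg_left h3 (sq_nonneg I.α)
  linarith

variable [Fintype S] [Fintype A]

/-- Expected features of `π` at stage `h`. -/
def featMean (M : EpisodicMDP S A H) (φ : S → A → Fin d → ℝ) (π : Policy S A H) (h : Fin H) :
    Fin d → ℝ :=
  fun i => mean (trajProb M M.init π) fun τ => feat φ h τ i

theorem mean_feat_dotProduct (M : EpisodicMDP S A H) (φ : S → A → Fin d → ℝ) (π : Policy S A H)
    (h : Fin H) (w : Fin d → ℝ) :
    mean (trajProb M M.init π) (fun τ => feat φ h τ ⬝ᵥ w) = featMean M φ π h ⬝ᵥ w := by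
  simp only [dotProduct, mean_sum, featMean, mean_mul_const]

theorem mean_totalCost_linear (M : EpisodicMDP S A H) (φ : S → A → Fin d → ℝ) (π : Policy S A H)
    (w : Fin H → Fin d → ℝ) :
    mean (trajProb M M.init π) (totalCost fun h s a => φ s a ⬝ᵥ w h)
      = ∑ h, featMean M φ π h ⬝ᵥ w h := by
  unfold totalCost
  rw [mean_sum]
  exact Finset.sum_congr rfl fun h _ => mean_feat_dotProduct M φ π h (w h)

variable [Nonempty A]

/-- The expected squared distance to `w` is the potential: it starts at no more than `4 * d * H` and
stays nonnegative. The policy and the weights are fixed by the past, so averaging the sampled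
gradient over the next episode yields `featMean` exactly. -/
theorem sum_pathMean_costWeight_le (M : EpisodicMDP S A H) {I : Input S A d H}
    (hφ : ∀ s a, ∑ i, |I.φ s a i| ≤ 1) (hcl : IsClosed I.W) (hconv : Convex ℝ I.W)
    (hbd : ∀ w ∈ I.W, ∀ i, |w i| ≤ 1) (hw₁ : ∀ h, I.w₁ h ∈ I.W) {e : Fin H → Fin d → ℝ}
    (he : ∀ h, ∑ i, |e h i| ≤ 1) {w : Fin H → Fin d → ℝ} (hw : ∀ h, w h ∈ I.W) (K : ℕ) :
    2 * I.α * ∑ k ∈ Finset.range K, pathMean (episodeLaw M I e) k (fun ω =>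
        ∑ h, (e h - featMean M I.φ (policy I e k ω) h) ⬝ᵥ (costWeight I e k ω h - w h))
      ≤ 4 * d * H + K * (4 * I.α ^ 2 * H) := by
  set P : ℕ → ℝ := fun k => pathMean (episodeLaw M I e) k fun ω =>
    ∑ h, (costWeight I e k ω h - w h) ⬝ᵥ (costWeight I e k ω h - w h) with hP
  have hP0 : P 0 ≤ 4 * d * H := by
    simp only [hP, pathMean_zero]
    refine (Finset.sum_le_sum (g := fun _ => (d : ℝ) * 2 ^ 2) fun h _ =>
      dotProduct_self_le_of_abs_le fun i => ?_).trans_eq ?_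
    · refine (abs_sub _ _).trans ?_
      linarith [hbd _ (costWeight_mem hcl hbd hw₁ e 0 Fin.elim0 h) i, hbd _ (hw h) i]
    · simp; ring
  have hPnonneg : ∀ k, 0 ≤ P k := fun k =>
    (isProb_pathProb (isProb_episodeLaw M I e) k).le_mean_of_le fun ω =>
      Finset.sum_nonneg fun h _ => dotProduct_self_nonneg' _
  have hstep : ∀ k, 2 * I.α * pathMean (episodeLaw M I e) k (fun ω =>
        ∑ h, (e h - featMean M I.φ (policy I e k ω) h) ⬝ᵥ (costWeight I e k ω h - w h))
      ≤ P k - P (k + 1) + 4 * I.α ^ 2 * H := fun k => by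
    have hp := isProb_pathProb (isProb_episodeLaw M I e) k
    simp only [hP]
    rw [pathMean_succ]
    unfold pathMean
    rw [← mean_const_mul, ← mean_sub, ← hp.mean_const (4 * I.α ^ 2 * H), ← mean_add]
    refine hp.mean_mono fun ω _ => ?_
    have hq := isProb_episodeLaw M I e k ω
    have h1 : ∑ h, (e h - featMean M I.φ (policy I e k ω) h) ⬝ᵥ (costWeight I e k ω h - w h)
        = mean (episodeLaw M I e k ω) fun τ => ∑ h, (e h - feat I.φ h τ) ⬝ᵥ
          (costWeight I e k ω h - w h) := by
      rw [mean_sum]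
      refine Finset.sum_congr rfl fun h _ => ?_
      simp only [sub_dotProduct (e h)]
      rw [mean_sub, hq.mean_const, episodeLaw, mean_feat_dotProduct]
    rw [h1, ← mean_const_mul]
    rw [← hq.mean_const (∑ h, (costWeight I e k ω h - w h) ⬝ᵥ (costWeight I e k ω h - w h)),
      ← mean_sub, ← hq.mean_const (4 * I.α ^ 2 * H), ← mean_add]
    refine hq.mean_mono fun τ _ => ?_
    have e1 : 4 * I.α ^ 2 * H = ∑ _h : Fin H, 4 * I.α ^ 2 := by simp; ring
    rw [Finset.mul_sum, e1, ← Finset.sum_sub_distrib, ← Finset.sum_add_distrib]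
    exact Finset.sum_le_sum fun h _ => costWeight_step hφ hcl hconv hbd he ω τ h (hw h)
  have hsum := Finset.sum_le_sum fun k (_ : k ∈ Finset.range K) => hstep k
  rw [← Finset.mul_sum, Finset.sum_add_distrib, Finset.sum_range_sub'] at hsum
  simp only [Finset.sum_const, Finset.card_range, nsmul_eq_mul] at hsum
  linarith [hPnonneg K]

/-- The gap under the true cost splits into the gap under the current cost, the regret of the
cost weights and the estimation error of the expert features. -/
theorem gap_decomposition (M : EpisodicMDP S A H) (I : Input S A d H) (e : Fin H → Fin d → ℝ)
    {c : Fin H → S → A → ℝ} {w : Fin H → Fin d → ℝ} (hc : ∀ h s a, c h s a = I.φ s a ⬝ᵥ w h)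
    (πE : Policy S A H) {k : ℕ} (ω : Fin k → Trajectory S A H) :
    gap M c (policy I e k ω) πE = gap M (currentCost I e ω) (policy I e k ω) πE
      + ∑ h, (e h - featMean M I.φ (policy I e k ω) h) ⬝ᵥ (costWeight I e k ω h - w h)
      + ∑ h, ((e h - featMean M I.φ πE h) ⬝ᵥ w h
        - (e h - featMean M I.φ πE h) ⬝ᵥ costWeight I e k ω h) := by
  have hc' : c = fun h s a => I.φ s a ⬝ᵥ w h := by funext h s a; exact hc h s a
  have hcur : currentCost I e ω = fun h s a => I.φ s a ⬝ᵥ costWeight I e k ω h := rfl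
  rw [gap_eq, gap_eq, hc', hcur]
  simp only [mean_totalCost_linear]
  rw [← Finset.sum_sub_distrib, ← Finset.sum_sub_distrib, ← Finset.sum_add_distrib,
    ← Finset.sum_add_distrib]
  refine Finset.sum_congr rfl fun h _ => ?_
  simp only [sub_dotProduct, dotProduct_sub]
  ring

theorem neg_dotProduct_le_sum_abs {u w : Fin d → ℝ} (hw : ∀ i, |w i| ≤ 1) :
    -(u ⬝ᵥ w) ≤ ∑ i, |u i| := by
  refine (neg_le_abs _).trans ((Finset.abs_sum_le_sum_abs _ _).trans ?_)
  refine Finset.sum_le_sum fun i _ => ?_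
  rw [abs_mul]
  exact mul_le_of_le_one_right (abs_nonneg _) (hw i)

/-- Bound on the cumulative gap, for fixed expert feature estimates `e`. -/
theorem sum_pathMean_gap_le {M : EpisodicMDP S A H} {I : Input S A d H}
    (hM : IsLinearMDP M I.φ) (harg : ∀ (f : A → ℝ) (a : A), f (I.argmin f) ≤ f a)
    {K m Bx Bp R : ℕ} {L : ℝ} (hpar : NetParams d H K I.β m Bx Bp R L) {r : ℝ} (hr : 0 < r)
    (hcl : IsClosed I.W) (hconv : Convex ℝ I.W) (hbd : ∀ w ∈ I.W, ∀ i, |w i| ≤ 1)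
    (hw₁ : ∀ h, I.w₁ h ∈ I.W) (hα : 0 < I.α) {e : Fin H → Fin d → ℝ}
    (he : ∀ h, ∑ i, |e h i| ≤ 1) {c : Fin H → S → A → ℝ} {w : Fin H → Fin d → ℝ}
    (hw : ∀ h, w h ∈ I.W) (hc : ∀ h s a, c h s a = I.φ s a ⬝ᵥ w h) (πE : Policy S A H) :
    ∑ k ∈ Finset.range K, pathMean (episodeLaw M I e) k (fun ω => gap M c (policy I e k ω) πE)
      ≤ 2 * H + K * (2 * H * ((net d H Bx Bp R).card * Real.exp (-L)) + I.β * H / r)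
        + 2 * I.β * r * (H * (d * Real.log (d * (K + 1))))
        + (2 * d * H / I.α + 2 * K * I.α * H)
        + K * ∑ h, ((e h - featMean M I.φ πE h) ⬝ᵥ w h
          + ∑ i, |e h i - featMean M I.φ πE h i|) := by
  have hmem := costWeight_mem hcl hbd hw₁ e
  have h1 := sum_pathMean_gap_currentCost_le hM harg hpar hr e (fun k ω h => hbd _ (hmem k ω h)) πE
  have h2 := sum_pathMean_costWeight_le M hM.1 hcl hconv hbd hw₁ he hw K
  set G := ∑ k ∈ Finset.range K, pathMean (episodeLaw M I e) k (fun ω =>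
        ∑ h, (e h - featMean M I.φ (policy I e k ω) h) ⬝ᵥ (costWeight I e k ω h - w h)) with hG
  have h3 : G ≤ 2 * d * H / I.α + 2 * K * I.α * H := by
    have e1 : 2 * d * H / I.α + 2 * K * I.α * H
        = (4 * d * H + K * (4 * I.α ^ 2 * H)) / (2 * I.α) := by field_simp; ring
    rw [e1, le_div_iff₀ (by positivity)]
    linarith
  have h4 : ∀ k, pathMean (episodeLaw M I e) k (fun ω => gap M c (policy I e k ω) πE)
      ≤ pathMean (episodeLaw M I e) k
          (fun ω => gap M (currentCost I e ω) (policy I e k ω) πE)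
        + pathMean (episodeLaw M I e) k (fun ω =>
          ∑ h, (e h - featMean M I.φ (policy I e k ω) h) ⬝ᵥ (costWeight I e k ω h - w h))
        + ∑ h, ((e h - featMean M I.φ πE h) ⬝ᵥ w h
          + ∑ i, |e h i - featMean M I.φ πE h i|) := fun k => by
    have hp := isProb_pathProb (isProb_episodeLaw M I e) k
    unfold pathMean
    rw [← mean_add, ← hp.mean_const (∑ h, ((e h - featMean M I.φ πE h) ⬝ᵥ w h
          + ∑ i, |e h i - featMean M I.φ πE h i|)), ← mean_add]
    refine hp.mean_mono fun ω _ => ?_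
    rw [gap_decomposition M I e hc πE ω]
    refine add_le_add le_rfl (Finset.sum_le_sum fun h _ => ?_)
    rw [sub_eq_add_neg]
    exact add_le_add le_rfl (neg_dotProduct_le_sum_abs (u := e h - featMean M I.φ πE h)
      (hbd _ (hmem k ω h)))
  have h5 := Finset.sum_le_sum fun k (_ : k ∈ Finset.range K) => h4 k
  rw [Finset.sum_add_distrib, Finset.sum_add_distrib, Finset.sum_const, Finset.card_range,
    nsmul_eq_mul] at h5
  linarith

end CostWeights

/-! ### Estimation of the expert features -/

section Expert

variable {T : Type*} [Fintype T]

theorem pathMean_iid_sum {p : T → ℝ} (hp : IsProb p) (X : T → ℝ) (hX : mean p X = 0) (n : ℕ) :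
    pathMean (fun _ _ => p) n (fun D => ∑ j, X (D j)) = 0 := by
  induction n with
  | zero => rw [pathMean_zero]; simp
  | succ n ih =>
    rw [pathMean_succ]
    simp only [Fin.sum_univ_castSucc, Fin.snoc_castSucc, Fin.snoc_last, mean_add, hp.mean_const,
      hX, add_zero]
    exact ih

theorem pathMean_iid_sum_sq {p : T → ℝ} (hp : IsProb p) (X : T → ℝ) (hX : mean p X = 0) (n : ℕ) :
    pathMean (fun _ _ => p) n (fun D => (∑ j, X (D j)) ^ 2) = n * mean p fun t => X t ^ 2 := by
  induction n with
  | zero => rw [pathMean_zero]; simp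
  | succ n ih =>
    rw [pathMean_succ]
    simp only [Fin.sum_univ_castSucc, Fin.snoc_castSucc, Fin.snoc_last, add_sq, mean_add,
      hp.mean_const, mean_const_mul, hX, mul_zero, add_zero]
    have h := isProb_pathProb (κ := fun _ _ => p) (fun _ _ => hp) n
    have h2 : pathMean (fun _ _ => p) n (fun D => (∑ j, X (D j)) ^ 2 + mean p fun t => X t ^ 2)
        = pathMean (fun _ _ => p) n (fun D => (∑ j, X (D j)) ^ 2) + mean p fun t => X t ^ 2 := by
      unfold pathMean
      rw [mean_add, h.mean_const]
    rw [h2, ih]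
    push_cast
    ring

theorem mean_sub_mean_sq_le {p : T → ℝ} (hp : IsProb p) (X : T → ℝ) :
    mean p (fun t => (X t - mean p X) ^ 2) ≤ mean p fun t => X t ^ 2 := by
  have h : ∀ t, (X t - mean p X) ^ 2 = X t ^ 2 - 2 * mean p X * X t + mean p X ^ 2 := fun t => by
    ring
  simp only [h]
  rw [mean_add, mean_sub, mean_const_mul, hp.mean_const]
  nlinarith [sq_nonneg (mean p X)]

variable [Fintype S] [Fintype A]

theorem expertFeatures_sub_eq (M : EpisodicMDP S A H) (I : Input S A d H) (πE : Policy S A H)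
    {n : ℕ} (hn : 0 < n) (D : Fin n → Trajectory S A H) (h : Fin H) (i : Fin d) :
    expertFeatures I D h i - featMean M I.φ πE h i
      = (n : ℝ)⁻¹ * ∑ j, (feat I.φ h (D j) i - featMean M I.φ πE h i) := by
  have hn' : (n : ℝ) ≠ 0 := by positivity
  rw [Finset.sum_sub_distrib, Finset.sum_const, Finset.card_univ, Fintype.card_fin, nsmul_eq_mul,
    mul_sub, inv_mul_cancel_left₀ hn', expertFeatures, Pi.smul_apply, Finset.sum_apply]
  rfl

theorem mean_feat_sub (M : EpisodicMDP S A H) (φ : S → A → Fin d → ℝ) (πE : Policy S A H)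
    (h : Fin H) (i : Fin d) :
    mean (trajProb M M.init πE) (fun τ => feat φ h τ i - featMean M φ πE h i) = 0 := by
  rw [mean_sub, (isProb_trajProb _ _ _).mean_const]
  exact sub_self _

omit [Fintype S] [Fintype A] in
theorem sum_abs_expertFeatures_le {I : Input S A d H} (hφ : ∀ s a, ∑ i, |I.φ s a i| ≤ 1) {n : ℕ}
    (hn : 0 < n) (D : Fin n → Trajectory S A H) (h : Fin H) :
    ∑ i, |expertFeatures I D h i| ≤ 1 := by
  have h1 := sum_abs_sum_smul_le Finset.univ (x := fun j => feat I.φ h (D j)) (fun j => hφ _ _)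
    (y := fun _ => (n : ℝ)⁻¹) (a := (n : ℝ)⁻¹) fun j _ => by rw [abs_of_nonneg (by positivity)]
  rw [← Finset.smul_sum, Finset.card_univ, Fintype.card_fin, mul_inv_cancel₀ (by positivity)] at h1
  exact h1

theorem mean_expertFeatures_sub (M : EpisodicMDP S A H) (I : Input S A d H) (πE : Policy S A H)
    {n : ℕ} (hn : 0 < n) (h : Fin H) (w : Fin d → ℝ) :
    mean (datasetProb M πE (n := n))
      (fun D => (expertFeatures I D h - featMean M I.φ πE h) ⬝ᵥ w) = 0 := by
  simp only [dotProduct, Pi.sub_apply, expertFeatures_sub_eq M I πE hn]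
  rw [mean_sum]
  refine Finset.sum_eq_zero fun i _ => ?_
  rw [mean_mul_const, mean_const_mul]
  have := pathMean_iid_sum (isProb_trajProb M M.init πE) _ (mean_feat_sub M I.φ πE h i) n
  change mean (datasetProb M πE) _ = 0 at this
  rw [this, mul_zero, zero_mul]

/-- Each absolute value is traded for a second moment by AM–GM with weight `r`. The variances of the
empirical means sum over coordinates to at most `1 / n`, since the squared Euclidean norm of a
feature is at most one; the dimension enters only through `d / r`. -/
theorem mean_sum_abs_expertFeatures_sub_le (M : EpisodicMDP S A H) {I : Input S A d H}
    (hφ : ∀ s a, ∑ i, |I.φ s a i| ≤ 1) (πE : Policy S A H) {n : ℕ} (hn : 0 < n) (h : Fin H)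
    {r : ℝ} (hr : 0 < r) :
    mean (datasetProb M πE (n := n))
      (fun D => ∑ i, |expertFeatures I D h i - featMean M I.φ πE h i|) ≤ (r / n + d / r) / 2 := by
  have hn' : (0 : ℝ) < n := by positivity
  have hp : IsProb (datasetProb M πE (n := n)) :=
    isProb_pathProb (κ := fun _ _ => trajProb M M.init πE) (fun _ _ => isProb_trajProb _ _ _) n
  have hq := isProb_trajProb M M.init πE
  have hvar : ∀ i, mean (datasetProb M πE (n := n))
      (fun D => (expertFeatures I D h i - featMean M I.φ πE h i) ^ 2)
      ≤ (n : ℝ)⁻¹ * mean (trajProb M M.init πE) fun τ => feat I.φ h τ i ^ 2 := fun i => by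
    have h1 := pathMean_iid_sum_sq hq _ (mean_feat_sub M I.φ πE h i) n
    change mean (datasetProb M πE) _ = _ at h1
    simp only [expertFeatures_sub_eq M I πE hn, mul_pow]
    rw [mean_const_mul, h1]
    have h2 := mean_sub_mean_sq_le hq fun τ => feat I.φ h τ i
    have e : ((n : ℝ)⁻¹) ^ 2 * (n * mean (trajProb M M.init πE)
        fun τ => (feat I.φ h τ i - featMean M I.φ πE h i) ^ 2)
        = (n : ℝ)⁻¹ * mean (trajProb M M.init πE)
          fun τ => (feat I.φ h τ i - featMean M I.φ πE h i) ^ 2 := by field_simp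
    rw [e]
    exact mul_le_mul_of_nonneg_left h2 (by positivity)
  have hsum : ∑ i, mean (trajProb M M.init πE) (fun τ => feat I.φ h τ i ^ 2) ≤ 1 := by
    rw [← mean_sum]
    refine hq.mean_le_of_le fun τ => ?_
    have := dotProduct_self_le_sq (hφ (τ.1 h.castSucc) (τ.2 h))
    simpa only [feat, dotProduct, sq, one_mul] using this
  have habs : ∀ x : ℝ, |x| ≤ (r * x ^ 2 + 1 / r) / 2 := fun x => by
    have h1 := sqrt_le_of_pos (sq_nonneg x) hr
    rw [Real.sqrt_sq_eq_abs] at h1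
    linarith
  calc _ ≤ mean (datasetProb M πE (n := n)) (fun D => ∑ i,
        (r * (expertFeatures I D h i - featMean M I.φ πE h i) ^ 2 + 1 / r) / 2) :=
        hp.mean_mono fun D _ => Finset.sum_le_sum fun i _ => habs _
    _ = ∑ i, (r * mean (datasetProb M πE (n := n))
        (fun D => (expertFeatures I D h i - featMean M I.φ πE h i) ^ 2) + 1 / r) / 2 := by
        rw [mean_sum]
        refine Finset.sum_congr rfl fun i _ => ?_
        simp only [div_eq_mul_inv _ (2 : ℝ)]
        rw [mean_mul_const, mean_add, mean_const_mul, hp.mean_const]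
    _ ≤ ∑ i, (r * ((n : ℝ)⁻¹ * mean (trajProb M M.init πE) fun τ => feat I.φ h τ i ^ 2)
        + 1 / r) / 2 := Finset.sum_le_sum fun i _ => by
        have := mul_le_mul_of_nonneg_left (hvar i) hr.le
        linarith
    _ = (r / n * (∑ i, mean (trajProb M M.init πE) fun τ => feat I.φ h τ i ^ 2)
        + d / r) / 2 := by
        rw [← Finset.sum_div, Finset.sum_add_distrib, Finset.mul_sum]
        simp only [Finset.sum_const, Finset.card_univ, Fintype.card_fin, nsmul_eq_mul]
        congr 2
        · exact Finset.sum_congr rfl fun i _ => by ring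
        · ring
    _ ≤ (r / n + d / r) / 2 := by
        have := mul_le_of_le_one_right (div_nonneg hr.le hn'.le) hsum
        linarith

/-- With `n ≥ d H ^ 2 / εE ^ 2` trajectories, the total estimation error is at most `εE`. -/
theorem mean_expert_error_le (M : EpisodicMDP S A H) {I : Input S A d H} (hd : 1 ≤ d) (hH : 1 ≤ H)
    (hφ : ∀ s a, ∑ i, |I.φ s a i| ≤ 1) (πE : Policy S A H) {n : ℕ} {εE : ℝ} (hε : 0 < εE)
    (hn : H ^ 2 * d / εE ^ 2 ≤ n) (w : Fin H → Fin d → ℝ) :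
    mean (datasetProb M πE (n := n)) (fun D => ∑ h,
      ((expertFeatures I D h - featMean M I.φ πE h) ⬝ᵥ w h
        + ∑ i, |expertFeatures I D h i - featMean M I.φ πE h i|)) ≤ εE := by
  have hd' : (0 : ℝ) < d := by exact_mod_cast hd
  have hH' : (0 : ℝ) < H := by exact_mod_cast hH
  have hn0 : (0 : ℝ) < n := lt_of_lt_of_le (by positivity) hn
  have hn1 : 0 < n := by exact_mod_cast hn0
  -- With this weight in the AM–GM bound, both `r / n` and `d / r` are at most `εE / H`, which sums
  -- to `εE` over the stages.
  have hr : 0 < d * H / εE := by positivity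
  rw [mean_sum]
  refine (Finset.sum_le_sum (g := fun _ => εE / H) fun h _ => ?_).trans_eq ?_
  · rw [mean_add, mean_expertFeatures_sub M I πE hn1, zero_add]
    refine (mean_sum_abs_expertFeatures_sub_le M hφ πE hn1 h hr).trans ?_
    have h1 : d * H / εE / n ≤ εE / H := by
      rw [div_le_div_iff₀ hn0 hH']
      rw [div_le_iff₀ (by positivity)] at hn
      rw [div_mul_eq_mul_div, div_le_iff₀ hε]
      nlinarith
    have h2 : d / (d * H / εE) = εE / H := by field_simp
    linarith
  · simp; field_simp

variable [Nonempty A]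

omit [Fintype S] in
/-- The run of BRIG as an adaptively generated sequence of episodes. -/
theorem runProb_eq_pathProb (M : EpisodicMDP S A H) (I : Input S A d H) (e : Fin H → Fin d → ℝ)
    (K : ℕ) : runProb M I e (K := K) = pathProb (fun k ω => trajProb M M.init (policy I e k ω)) K :=
  rfl

/-- The uniform choice of the output is a plain average over episodes, and each summand depends only
on the episodes before it, so the rest of the run integrates out. -/
theorem expectedSuboptimality_eq (M : EpisodicMDP S A H) (I : Input S A d H)
    (c : Fin H → S → A → ℝ) (πE : Policy S A H) (K n : ℕ) :
    expectedSuboptimality M I c πE K n = mean (datasetProb M πE (n := n)) fun D =>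
      (K : ℝ)⁻¹ * ∑ k ∈ Finset.range K, pathMean (episodeLaw M I (expertFeatures I D)) k
        fun ω => gap M c (policy I (expertFeatures I D) k ω) πE := by
  unfold expectedSuboptimality
  change mean _ _ = _
  congr 1
  funext D
  rw [runProb_eq_pathProb, ← Fin.sum_univ_eq_sum_range (fun k => pathMean
    (episodeLaw M I (expertFeatures I D)) k fun ω =>
      gap M c (policy I (expertFeatures I D) k ω) πE) K]
  change mean _ _ = _
  rw [mean_const_mul, mean_sum]
  congr 1
  refine Finset.sum_congr rfl fun k _ => ?_
  exact pathMean_take (isProb_episodeLaw M I (expertFeatures I D)) k.is_lt.le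
    fun ω => gap M c (policy I (expertFeatures I D) k ω) πE

/-- Suboptimality of BRIG in terms of the parameters of the analysis. -/
theorem expectedSuboptimality_le {M : EpisodicMDP S A H} {I : Input S A d H} (hd : 1 ≤ d)
    (hM : IsLinearMDP M I.φ) (harg : ∀ (f : A → ℝ) (a : A), f (I.argmin f) ≤ f a)
    {K m Bx Bp R : ℕ} {L : ℝ} (hK : 1 ≤ K) (hpar : NetParams d H K I.β m Bx Bp R L) {r : ℝ}
    (hr : 0 < r) (hcl : IsClosed I.W) (hconv : Convex ℝ I.W) (hbd : ∀ w ∈ I.W, ∀ i, |w i| ≤ 1)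
    (hw₁ : ∀ h, I.w₁ h ∈ I.W) (hα : 0 < I.α) {c : Fin H → S → A → ℝ}
    (hc : IsRealizable I.φ I.W c) (πE : Policy S A H) {n : ℕ} {εE : ℝ} (hε : 0 < εE)
    (hn : H ^ 2 * d / εE ^ 2 ≤ n) :
    expectedSuboptimality M I c πE K n ≤ (K : ℝ)⁻¹ * (2 * H
        + K * (2 * H * ((net d H Bx Bp R).card * Real.exp (-L)) + I.β * H / r)
        + 2 * I.β * r * (H * (d * Real.log (d * (K + 1))))
        + (2 * d * H / I.α + 2 * K * I.α * H)) + εE := by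
  obtain ⟨w, hw, hcw⟩ := hc
  have hd' : (0 : ℝ) < d := by exact_mod_cast hd
  have hH' : (0 : ℝ) < H := by exact_mod_cast hpar.horizon_pos
  have hK' : (0 : ℝ) < K := by exact_mod_cast hK
  have hn0 : (0 : ℝ) < n := lt_of_lt_of_le (by positivity) hn
  have hn1 : 0 < n := by exact_mod_cast hn0
  have hp : IsProb (datasetProb M πE (n := n)) :=
    isProb_pathProb (κ := fun _ _ => trajProb M M.init πE) (fun _ _ => isProb_trajProb _ _ _) n
  rw [expectedSuboptimality_eq]
  refine le_trans ?_ (add_le_add le_rfl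
    (mean_expert_error_le M hd hpar.horizon_pos hM.1 πE hε hn w))
  rw [← hp.mean_const ((K : ℝ)⁻¹ * _), ← mean_add]
  refine hp.mean_mono fun D _ => ?_
  have h1 := sum_pathMean_gap_le hM harg hpar hr hcl hconv hbd hw₁ hα
    (fun h => sum_abs_expertFeatures_le hM.1 hn1 D h) hw hcw πE
  refine (mul_le_mul_of_nonneg_left h1 (inv_nonneg.2 hK'.le)).trans_eq ?_
  rw [mul_add, inv_mul_cancel_left₀ hK'.ne']

end Expert

/-! ### Choice of the parameters -/

section Parameters

theorem add_le_pow_succ {X a b : ℝ} {n : ℕ} (hX : 2 ≤ X) (ha : a ≤ X ^ n) (hb : b ≤ X ^ n) :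
    a + b ≤ X ^ (n + 1) := by
  have h : (0 : ℝ) ≤ X ^ n := by positivity
  rw [pow_succ]
  nlinarith

theorem mul_le_pow_add {X a b : ℝ} {n l : ℕ} (hX : 2 ≤ X) (hb0 : 0 ≤ b) (ha : a ≤ X ^ n)
    (hb : b ≤ X ^ l) : a * b ≤ X ^ (n + l) := by
  rw [pow_add]
  exact mul_le_mul ha hb hb0 (by positivity)

/-- The size of the family for the union bound is a power of `X` of order `d ^ 2`. -/
theorem card_net_mul_exp_le {d H Bx Bp R : ℕ} {X : ℝ} (hX : 2 ≤ X) (hd : 1 ≤ d)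
    (hH : (H : ℝ) ≤ X) (hBx : (2 * Bx + 1 : ℝ) ≤ X ^ 99) (hBp : (2 * Bp + 1 : ℝ) ≤ X ^ 169)
    (hR : (2 * R ^ 2 + 1 : ℝ) ≤ X ^ 120) :
    (net d H Bx Bp R).card * Real.exp (-(395 * d ^ 2 * Real.log X)) ≤ (X ^ 6)⁻¹ := by
  have hX0 : 0 < X := by linarith
  have hX1 : 1 ≤ X := by linarith
  have hcard : ((net d H Bx Bp R).card : ℝ) ≤ X ^ (389 * d ^ 2) := by
    rw [card_net]
    push_cast
    calc (H : ℝ) * ((2 * Bx + 1) ^ d * ((2 * Bp + 1) ^ d * (2 * R ^ 2 + 1) ^ (d * d)))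
        ≤ X * ((X ^ 99) ^ d * ((X ^ 169) ^ d * (X ^ 120) ^ (d * d))) := by gcongr
      _ = X ^ (1 + 99 * d + 169 * d + 120 * (d * d)) := by
          rw [pow_add, pow_add, pow_add, pow_one, pow_mul, pow_mul, pow_mul]; ring
      _ ≤ X ^ (389 * d ^ 2) := pow_le_pow_right₀ hX1 (by nlinarith)
  have hexp : Real.exp (-(395 * d ^ 2 * Real.log X)) = (X ^ (395 * d ^ 2))⁻¹ := by
    rw [Real.exp_neg]
    congr 1
    have : (395 * d ^ 2 * Real.log X : ℝ) = Real.log (X ^ (395 * d ^ 2)) := by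
      rw [Real.log_pow]; push_cast; ring
    rw [this, Real.exp_log (by positivity)]
  rw [hexp, ← div_eq_mul_inv, div_le_iff₀ (by positivity), inv_mul_eq_div,
    le_div_iff₀ (by positivity)]
  calc ((net d H Bx Bp R).card : ℝ) * X ^ 6 ≤ X ^ (389 * d ^ 2) * X ^ 6 := by gcongr
    _ = X ^ (389 * d ^ 2 + 6) := by rw [pow_add]
    _ ≤ X ^ (395 * d ^ 2) := pow_le_pow_right₀ hX1 (by nlinarith)

/-- The union-bound level is of order `d ^ 2 * l`, so the noise term is at most `80 * (d * H * √l)`;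
rounding and ridge bias add at most `2` units each, and `84` is below `2 ^ 7`. -/
theorem bonus_parameter_ge {d H : ℕ} {l : ℝ} (hd : 1 ≤ d) (hH : 1 ≤ H) (hl : 1 / 2 ≤ l) :
    4 * H * √(395 * d ^ 2 * l + 1) + 1 + √d * H ≤ 2 ^ 7 * (d * H * √l) := by
  have hd' : (1 : ℝ) ≤ d := by exact_mod_cast hd
  have hH' : (1 : ℝ) ≤ H := by exact_mod_cast hH
  have h1 : √(395 * d ^ 2 * l + 1) ≤ 20 * d * √l := by
    refine Real.sqrt_le_iff.2 ⟨by positivity, ?_⟩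
    rw [mul_pow, mul_pow, Real.sq_sqrt (by linarith)]
    nlinarith [one_le_pow₀ hd' (n := 2)]
  have h2 : 1 / 2 ≤ √l := Real.le_sqrt_of_sq_le (by linarith)
  have h3 : √(d : ℝ) ≤ d := Real.sqrt_le_iff.2 ⟨by linarith, by nlinarith⟩
  have h4 : 1 ≤ (d : ℝ) * H := by nlinarith
  have h5 : 4 * H * √(395 * d ^ 2 * l + 1) ≤ 80 * (d * H * √l) := by
    calc 4 * H * √(395 * d ^ 2 * l + 1) ≤ 4 * H * (20 * d * √l) := by gcongr
      _ = _ := by ring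
  have h6 : √d * H ≤ 2 * (d * H * √l) := by
    calc √d * H ≤ d * H := by gcongr
      _ ≤ 2 * (d * H * √l) := by nlinarith
  have h7 : 1 ≤ 2 * (d * H * √l) := by nlinarith
  linarith

set_option maxHeartbeats 1000000 in
-- With `X = d * H / ε ≥ 2`, every quantity is bounded by a fixed power of `X`, numerical constants
-- included. Thus all logarithms are of order `log X`, although `β`, `K` and the grid sizes depend
-- on one another. Each of the five error contributions is then at most `ε / 8`.
theorem exists_parameters {d H : ℕ} (hd : 1 ≤ d) (hH : 1 ≤ H) {ε : ℝ} (hε : 0 < ε)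
    (hε2 : ε ≤ 1 / 2) :
    ∃ (K : ℕ) (β : ℝ), 1 ≤ K ∧
      (K : ℝ) ≤ 2 ^ 41 * ((H : ℝ) ^ 4 * (d : ℝ) ^ 3 * Real.log (d * H / ε) ^ 2 / ε ^ 2) ∧
      0 ≤ β ∧ β ≤ 2 ^ 41 * (d * H * Real.log (d * H / ε)) ∧
      ∃ (m Bx Bp R : ℕ) (L r : ℝ), NetParams d H K β m Bx Bp R L ∧ 0 < r ∧
        (K : ℝ)⁻¹ * (2 * H
          + K * (2 * H * ((net d H Bx Bp R).card * Real.exp (-L)) + β * H / r)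
          + 2 * β * r * (H * (d * Real.log (d * (K + 1))))
          + (2 * d * H / √(1 / (2 * K)) + 2 * K * √(1 / (2 * K)) * H)) ≤ ε := by
  have hd' : (1 : ℝ) ≤ d := by exact_mod_cast hd
  have hH' : (1 : ℝ) ≤ H := by exact_mod_cast hH
  have hdH : (1 : ℝ) ≤ d * H := by nlinarith
  set X : ℝ := d * H / ε with hX
  have hXε : ε * X = d * H := by rw [hX]; field_simp
  have hX2 : 2 ≤ X := by
    rw [hX, le_div_iff₀ hε]; linarith
  have hX1 : 1 ≤ X := by linarith
  have hX0 : 0 < X := by linarith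
  have hdHX : d * H ≤ X := by rw [← hXε]; nlinarith
  have hdX : (d : ℝ) ≤ X := le_trans (by nlinarith) hdHX
  have hHX : (H : ℝ) ≤ X := le_trans (by nlinarith) hdHX
  set l := Real.log X with hl
  have hl1 : 1 / 2 ≤ l := by
    have h1 := Real.log_two_gt_d9
    have h2 := Real.log_le_log (by norm_num) hX2
    linarith
  have hl0 : 0 < l := by linarith
  have hlX : l ≤ X := by linarith [Real.log_le_sub_one_of_pos hX0]
  have hsl : √l ≤ X := Real.sqrt_le_iff.2 ⟨hX0.le, by nlinarith⟩
  have hsl2 : √l ≤ 2 * l := Real.sqrt_le_iff.2 ⟨by linarith, by nlinarith⟩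
  set Y : ℝ := (H : ℝ) ^ 4 * (d : ℝ) ^ 3 * l ^ 2 / ε ^ 2 with hY
  have hYX : Y ≤ X ^ 6 := by
    have h1 : (d * H : ℝ) ^ 2 / ε ^ 2 = X ^ 2 := by rw [hX, div_pow]
    calc Y = (d * H ^ 2) * ((d * H : ℝ) ^ 2 / ε ^ 2) * l ^ 2 := by rw [hY]; ring
      _ ≤ X ^ 2 * X ^ 2 * X ^ 2 := by
          rw [h1]
          have h2 : (d : ℝ) * H ^ 2 ≤ X ^ 2 := by
            calc (d : ℝ) * H ^ 2 = (d * H) * H := by ring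
              _ ≤ X * X := by gcongr
              _ = X ^ 2 := by ring
          gcongr
      _ = X ^ 6 := by ring
  have hYlow : (d * H) ^ 2 / ε ^ 2 / 4 ≤ Y := by
    have h1 : (1 : ℝ) / 4 ≤ l ^ 2 := by nlinarith
    have h2 : (1 : ℝ) ≤ H ^ 2 * d := by nlinarith
    calc (d * H : ℝ) ^ 2 / ε ^ 2 / 4 = ((d * H : ℝ) ^ 2 / ε ^ 2) * (1 * (1 / 4)) := by ring
      _ ≤ ((d * H : ℝ) ^ 2 / ε ^ 2) * ((H ^ 2 * d) * l ^ 2) := by gcongr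
      _ = Y := by rw [hY]; ring
  have hX2eq : (d * H : ℝ) ^ 2 / ε ^ 2 = X ^ 2 := by rw [hX, div_pow]
  rw [hX2eq] at hYlow
  have hY1 : 1 ≤ Y := by nlinarith
  set K : ℕ := ⌈2 ^ 40 * Y⌉₊ with hK
  have hKlow : 2 ^ 40 * Y ≤ K := Nat.le_ceil _
  have hKup : (K : ℝ) ≤ 2 ^ 41 * Y := by
    have := (Nat.ceil_lt_add_one (a := 2 ^ 40 * Y) (by positivity)).le
    linarith
  have hKpos : (0 : ℝ) < K := by linarith
  have hK1 : 1 ≤ K := by exact_mod_cast hKpos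
  have hKX : (K : ℝ) ≤ X ^ 47 :=
    hKup.trans (mul_le_pow_add (n := 41) hX2 (by positivity) (pow_le_pow_left₀ (by norm_num) hX2 41)
      hYX)
  set β : ℝ := 2 ^ 7 * (d * H * √l) with hβ
  have hβ0 : 0 < β := by positivity
  have hβX : β ≤ X ^ 9 := by
    refine mul_le_pow_add (n := 7) (l := 2) hX2 (by positivity)
      (pow_le_pow_left₀ (by norm_num) hX2 7) ?_
    exact mul_le_pow_add (n := 1) (l := 1) hX2 (by positivity) (by simpa using hdHX)
      (by simpa using hsl)
  have hone : ∀ n : ℕ, (1 : ℝ) ≤ X ^ n := fun n => one_le_pow₀ hX1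
  have htwo : (2 : ℝ) ≤ X ^ 1 := by simpa using hX2
  have h1β : 1 + β ≤ X ^ 10 := add_le_pow_succ hX2 (hone 9) hβX
  set R : ℕ := ⌈2 * K * (1 + β)⌉₊ with hR
  have hRX : (R : ℝ) ≤ X ^ 59 := by
    refine (Nat.ceil_lt_add_one (by positivity)).le.trans (add_le_pow_succ hX2 ?_ (hone 58))
    exact mul_le_pow_add (n := 48) (l := 10) hX2 (by positivity)
      (mul_le_pow_add (n := 1) (l := 47) hX2 hKpos.le htwo hKX) h1β
  have hR2 : (R : ℝ) ^ 2 ≤ X ^ 118 := by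
    calc (R : ℝ) ^ 2 ≤ (X ^ 59) ^ 2 := by gcongr
      _ = X ^ 118 := by rw [← pow_mul]
  -- Coarser than necessary: taking `K + d` instead of its square root keeps `m` a natural number
  -- without rounding, and costs only a larger power of `X`.
  set m : ℕ := 2 * H * (K + d) with hm
  have hmX : (m : ℝ) ≤ X ^ 50 := by
    rw [hm]
    push_cast
    refine mul_le_pow_add (n := 2) (l := 48) hX2 (by positivity)
      (mul_le_pow_add (n := 1) (l := 1) hX2 (by positivity) htwo (by simpa using hHX)) ?_
    exact add_le_pow_succ hX2 hKX (hdX.trans (by simpa using pow_le_pow_right₀ hX1 (show 1 ≤ 47 by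
      norm_num)))
  set Bx : ℕ := K * m with hBx
  have hBxX : (2 * Bx + 1 : ℝ) ≤ X ^ 99 := by
    refine add_le_pow_succ hX2 ?_ (hone 98)
    rw [hBx]
    push_cast
    exact mul_le_pow_add (n := 1) (l := 97) hX2 (by positivity) htwo
      (mul_le_pow_add (n := 47) (l := 50) hX2 (by positivity) hKX hmX)
  set Bp : ℕ := (K * H + 1) * R ^ 2 with hBp
  have hBpX : (2 * Bp + 1 : ℝ) ≤ X ^ 169 := by
    refine add_le_pow_succ hX2 ?_ (hone 168)
    rw [hBp]
    push_cast
    refine mul_le_pow_add (n := 1) (l := 167) hX2 (by positivity) htwo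
      (mul_le_pow_add (n := 49) (l := 118) hX2 (by positivity) ?_ hR2)
    exact add_le_pow_succ hX2 (mul_le_pow_add (n := 47) (l := 1) hX2 (by positivity) hKX
      (by simpa using hHX)) (hone 48)
  have hR2X : (2 * R ^ 2 + 1 : ℝ) ≤ X ^ 120 :=
    add_le_pow_succ hX2 (mul_le_pow_add (n := 1) (l := 118) hX2 (by positivity) htwo hR2)
      (hone 119)
  have hpar : NetParams d H K β m Bx Bp R (395 * d ^ 2 * l) := by
    refine ⟨hH, by positivity, Nat.ceil_pos.2 (by positivity), by positivity, le_rfl, le_rfl, ?_,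
      Nat.le_ceil _, bonus_parameter_ge hd hH hl1⟩
    have h1 : K + d ≤ (K + d) ^ 2 := Nat.le_self_pow two_ne_zero _
    calc 4 * H ^ 2 * (K + d) ≤ 4 * H ^ 2 * (K + d) ^ 2 := Nat.mul_le_mul_left _ h1
      _ = m ^ 2 := by rw [hm]; ring
  -- The level exceeds the exponent `389 * d ^ 2` of the net size by enough to leave a failure
  -- probability of `(X ^ 6)⁻¹`. The choice of `r` makes `β * H / r` equal to `ε / 8`.
  refine ⟨K, β, hK1, hKup, hβ0.le, ?_, m, Bx, Bp, R, 395 * d ^ 2 * l, 8 * β * H / ε, hpar,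
    by positivity, ?_⟩
  · calc β ≤ 2 ^ 7 * (d * H * (2 * l)) := by rw [hβ]; gcongr
      _ = 2 ^ 8 * (d * H * l) := by ring
      _ ≤ 2 ^ 41 * (d * H * l) := by gcongr <;> norm_num
  have hKX2 : 2 ^ 38 * X ^ 2 ≤ K := by linarith
  have t1 : 2 * H ≤ K * (ε / 8) := by
    have h1 : 2 ^ 38 * X ^ 2 * (ε / 8) ≤ K * (ε / 8) := by gcongr
    have h2 : 2 ^ 38 * X ^ 2 * (ε / 8) = 2 ^ 35 * (X * (d * H)) := by rw [← hXε]; ring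
    have h3 : 1 * (1 * (H : ℝ)) ≤ X * (d * H) := by gcongr
    linarith
  have t2 : 2 * H * ((net d H Bx Bp R).card * Real.exp (-(395 * d ^ 2 * l))) ≤ ε / 8 := by
    have h1 := card_net_mul_exp_le hX2 hd hHX hBxX hBpX hR2X
    have h2 : 16 * H ≤ ε * X ^ 6 := by
      have h3 : ε * X ^ 6 = (d * H) * X ^ 5 := by rw [← hXε]; ring
      have h4 : (2 : ℝ) ^ 5 ≤ X ^ 5 := pow_le_pow_left₀ (by norm_num) hX2 5
      calc (16 : ℝ) * H = 1 * H * 16 := by ring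
        _ ≤ d * H * X ^ 5 := by gcongr; linarith
        _ = ε * X ^ 6 := h3.symm
    calc _ ≤ 2 * H * (X ^ 6)⁻¹ := by gcongr
      _ ≤ ε / 8 := by
          rw [← div_eq_mul_inv, div_le_iff₀ (by positivity)]
          linarith
  have t3 : β * H / (8 * β * H / ε) = ε / 8 := by field_simp
  -- The potential term dictates the order of `K`: it is of order `β ^ 2 * H ^ 2 * d * l / ε`, and
  -- `β ^ 2` is of order `d ^ 2 * H ^ 2 * l`.
  have t4 : 2 * β * (8 * β * H / ε) * (H * (d * Real.log (d * (K + 1)))) ≤ K * (ε / 8) := by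
    have h1 : Real.log (d * (K + 1)) ≤ 49 * l := by
      have h2 : (d : ℝ) * (K + 1) ≤ X ^ 49 :=
        mul_le_pow_add (n := 1) (l := 48) hX2 (by positivity) (by simpa using hdX)
          (add_le_pow_succ hX2 hKX (hone 47))
      calc Real.log (d * (K + 1)) ≤ Real.log (X ^ 49) := Real.log_le_log (by positivity) h2
        _ = 49 * l := by rw [Real.log_pow, hl]; norm_num
    calc 2 * β * (8 * β * H / ε) * (H * (d * Real.log (d * (K + 1))))
        ≤ 2 * β * (8 * β * H / ε) * (H * (d * (49 * l))) := by gcongr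
      _ = 784 * 2 ^ 14 * (d ^ 3 * H ^ 4 * (√l ^ 2 * l) / ε) := by rw [hβ]; ring
      _ = 784 * 2 ^ 14 * (Y * ε) := by
          rw [Real.sq_sqrt hl0.le, hY]; field_simp
      _ ≤ 2 ^ 40 * Y * (ε / 8) := by
          have h2 : 0 < Y * ε := mul_pos (lt_of_lt_of_le one_pos hY1) hε
          have h3 : 2 ^ 40 * Y * (ε / 8) = 2 ^ 37 * (Y * ε) := by ring
          rw [h3]
          exact mul_le_mul_of_nonneg_right (by norm_num) h2.le
      _ ≤ K * (ε / 8) := by gcongr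
  set α := √(1 / (2 * (K : ℝ))) with hα
  have hα0 : 0 < α := Real.sqrt_pos.2 (by positivity)
  -- The step size satisfies `2 * K * α ^ 2 = 1`, so both parts of the gradient-descent regret are
  -- multiples of `K * α`.
  have hαK : 1 / α = 2 * K * α := by
    have h1 : α * α = 1 / (2 * K) := Real.mul_self_sqrt (by positivity)
    rw [div_eq_iff hα0.ne', mul_assoc, h1]
    field_simp
  have hαε : α ≤ ε / (48 * (d * H)) := by
    refine Real.sqrt_le_iff.2 ⟨by positivity, ?_⟩
    rw [div_pow, div_le_div_iff₀ (by positivity) (by positivity)]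
    have h1 : (d * H : ℝ) ^ 2 = ε ^ 2 * X ^ 2 := by rw [← hXε]; ring
    rw [mul_pow, h1]
    have h2 := mul_le_mul_of_nonneg_left hKX2 (sq_nonneg ε)
    have h3 : 0 ≤ ε ^ 2 * X ^ 2 := by positivity
    linarith
  have t5 : 2 * d * H / α + 2 * K * α * H ≤ K * (ε / 8) := by
    have h1 : 2 * d * H / α = 2 * K * (2 * d * H * α) := by
      rw [div_eq_mul_one_div, hαK]; ring
    have h2 : 48 * (d * H) * α ≤ ε := by
      rwa [le_div_iff₀ (by positivity), mul_comm] at hαε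
    have h3 : α * H ≤ d * H * α := by
      calc α * H = 1 * H * α := by ring
        _ ≤ d * H * α := by gcongr
    rw [h1]
    have h4 : 2 * K * (2 * d * H * α) + 2 * K * α * H = K * (4 * (d * H * α) + 2 * (α * H)) := by
      ring
    rw [h4]
    refine mul_le_mul_of_nonneg_left ?_ hKpos.le
    linarith
  rw [t3, inv_mul_le_iff₀ hKpos]
  have t6 := mul_le_mul_of_nonneg_left t2 hKpos.le
  rw [mul_add (K : ℝ)]
  have t7 : 0 < K * (ε / 8) := by positivity
  have t8 : K * ε = 8 * (K * (ε / 8)) := by ring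
  linarith

end Parameters

end BRIG

end

theorem theorem2 :
    ∃ C : ℝ, 0 < C ∧
      ∀ (d H : ℕ), 1 ≤ d → 1 ≤ H → ∀ ε : ℝ, 0 < ε → ε ≤ 1 / 2 →
      ∃ (K : ℕ) (β : ℝ), 1 ≤ K ∧
        (K : ℝ) ≤ C * ((H : ℝ) ^ 4 * (d : ℝ) ^ 3 * Real.log (d * H / ε) ^ 2 / ε ^ 2) ∧
        0 ≤ β ∧ β ≤ C * (d * H * Real.log (d * H / ε)) ∧
        ∀ (S A : Type*) [Fintype S] [Fintype A] [Nonempty A]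
          (M : BRIG.EpisodicMDP S A H) (φ : S → A → Fin d → ℝ),
          BRIG.IsLinearMDP M φ →
        ∀ W : Set (Fin d → ℝ), IsClosed W → Convex ℝ W → (∀ w ∈ W, ∀ i, |w i| ≤ 1) →
        ∀ c : Fin H → S → A → ℝ, BRIG.IsRealizable φ W c →
        ∀ πE : BRIG.Policy S A H,
        ∀ w₁ : Fin H → Fin d → ℝ, (∀ h, w₁ h ∈ W) →
        ∀ argmin : (A → ℝ) → A, (∀ (f : A → ℝ) (a : A), f (argmin f) ≤ f a) →
        ∀ (εE : ℝ) (τE : ℕ), 0 < εE →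
          2 * (H : ℝ) ^ 2 * d * Real.log (2 * d) / εE ^ 2 ≤ τE →
          BRIG.expectedSuboptimality M
            { φ := φ, W := W, β := β, α := Real.sqrt (1 / (2 * K)), w₁ := w₁, argmin := argmin }
            c πE K τE ≤ ε + εE := by
  refine ⟨2 ^ 41, by positivity, fun d H hd hH ε hε hε2 => ?_⟩
  obtain ⟨K, β, hK1, hK, hβ0, hβ, m, Bx, Bp, R, L, r, hpar, hr, hbound⟩ :=
    BRIG.exists_parameters hd hH hε hε2
  refine ⟨K, β, hK1, hK, hβ0, hβ, ?_⟩
  intro S A _ _ _ M φ hM W hcl hconv hbd c hc πE w₁ hw₁ argmin harg εE τE hεE hτE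
  -- The sample size in the theorem exceeds what the variance argument needs, because `2 * log (2 *
  -- d) ≥ 2 * log 2 > 1`.
  have hτ : (H : ℝ) ^ 2 * d / εE ^ 2 ≤ τE := by
    refine le_trans ?_ hτE
    have hd' : (1 : ℝ) ≤ d := by exact_mod_cast hd
    have hlog : 1 ≤ 2 * Real.log (2 * d) := by
      have h1 := Real.log_two_gt_d9
      have h2 : Real.log 2 ≤ Real.log (2 * d) := Real.log_le_log (by norm_num) (by linarith)
      linarith
    have h0 : (0 : ℝ) ≤ H ^ 2 * d / εE ^ 2 := by positivity
    calc (H : ℝ) ^ 2 * d / εE ^ 2 ≤ H ^ 2 * d / εE ^ 2 * (2 * Real.log (2 * d)) :=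
          le_mul_of_one_le_right h0 hlog
      _ = _ := by ring
  have hα : 0 < √(1 / (2 * (K : ℝ))) := by
    have : (0 : ℝ) < K := by exact_mod_cast hK1
    positivity
  exact (BRIG.expectedSuboptimality_le
    (I := { φ := φ, W := W, β := β, α := √(1 / (2 * K)), w₁ := w₁, argmin := argmin }) hd hM harg hK1 hpar hr hcl hconv hbd hw₁ hα
    hc πE hεE hτ).trans (add_le_add hbound le_rfl)
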